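/- Let $G$ be a group, $s\in G$, and let $\rho$ be an irreducible complex representation, on a space $V$, of the centralizer $G^s$ of $s$. All Yetter–Drinfeld (YD) modules below are left–left YD modules over the group algebra $kG$, $k=\mathbb C$, and $\mathfrak B(M)$ denotes the Nichols algebra of a YD module $M$, i.e. the quotient of the tensor algebra $T(M)$ (a graded braided Hopf algebra with the elements of $M$ primitive) by its largest homogeneous Hopf ideal in the category of YD modules contained in degrees $\ge 2$. *The module $M(\mathcal O_s,\rho)$.* For each $t$ in the conjugacy class $\mathcal O_s$ choose $g_t\in G$ with $g_tsg_t^{-1}=t$. Then $M(\mathcal O_s,\rho)=\bigoplus_{t\in\mathcal O_s} g_t\otimes V$ with coaction $\delta(g_tv)=t\otimes g_tv$ and action $h\cdot(g_tv)=g_{t'}(\gamma\cdot v)$, where $hg_t=g_{t'}\gamma$, $\gamma\in G^s$. Put $\mathfrak B(\mathcal O_s,\rho)=\mathfrak B(M(\mathcal O_s,\rho))$. *Ramification systems.* A ramification system with irreducible representations $(G,r,\overrightarrow\rho,u)$ consists of a cardinal $r_C$ and an element $u(C)\in C$ for each conjugacy class $C$ of $G$, a finite set $I_C(r,u)$ for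 each $C$, an irreducible right representation $\rho_C^{(i)}$ of $G^{u(C)}$ on a complex vector space $X_C^{(i)}$ for each $i\in I_C(r,u)$, and sets $J_C(i)$ with $|J_C(i)|=\deg\rho_C^{(i)}$, such that $r_C=|I_C(r)|$ for $I_C(r)=\{(i,j): i\in I_C(r,u),\ j\in J_C(i)\}$. It is bi-one if $r_C\neq0$ for exactly one class $C$ and $I_C(r,u)$ has exactly one element for this $C$. *The arrow YD module.* The Hopf quiver $Q$ of the system has vertex set $G$ and, for $x,y\in G$ with $x^{-1}y\in C$, the arrows $a_{y,x}^{(i,j)}$, $(i,j)\in I_C(r)$, from $x$ to $y$. Choose bases $\{x_C^{(i,j)}\}_{j\in J_C(i)}$ of the spaces $X_C^{(i)}$, and for each $C$ and $c\in C$ an element $\tau_c\in G$ with $\tau_c^{-1}u(C)\tau_c=c$ (right coset representatives of $G^{u(C)}$ in $G$). Then $kQ_1$ is a $kG$-Hopf bimodule with left and right coactions $a_{y,x}^{(i,j)}\mapsto y\otimes a_{y,x}^{(i,j)}$ and $a_{y,x}^{(i,j)}\mapsto a_{y,x}^{(i,j)}\otimes x$, and with $$g\cdot a_{y,x}^{(i,j)}=a_{gy,gx}^{(i,j)},\qquad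 a_{y,x}^{(i,j)}\cdot g=\sum_p\kappa_p\,a_{yg,xg}^{(i,p)},$$ where, for $c=x^{-1}y$ and $\zeta=\tau_c\,g\,\tau_{g^{-1}cg}^{-1}\in G^{u(C)}$, the scalars $\kappa_p$ are given by $x_C^{(i,j)}\cdot\zeta=\sum_p\kappa_p x_C^{(i,p)}$. With the action $g\rhd x=g\cdot x\cdot g^{-1}$ and the left coaction, $kQ_1$ is a YD module; the arrow YD module $kQ_1^1$ is its YD submodule spanned by the arrows starting at $1$, and the arrow Nichols algebra is $\mathfrak B(G,r,\overrightarrow\rho,u)=\mathfrak B(kQ_1^1)$. **Lemma.** There is a bi-one ramification system with irreducible representations $(G,r,\overrightarrow\rho,u)$ such that, for all choices of the $g_t$, of the $\tau_c$ and of the bases, $M(\mathcal O_s,\rho)\cong kQ_1^1$ as YD modules over $kG$, and $$\mathfrak B(\mathcal O_s,\rho)\cong\mathfrak B(G,r,\overrightarrow\rho,u)$$ as graded braided Hopf algebras in the category ${}^{kG}_{kG}\mathcal{YD}$ of YD modules over $kG$. -/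

import Mathlib

open scoped TensorProduct

universe u v w w'

noncomputable section

namespace BiOneNichols

/-! ### Yetter-Drinfeld modules over a group algebra -/

section YD

variable {k : Type u} {G : Type v} [Field k] [Group G]

/-- The group-like element of `kG` given by `g`. -/
abbrev gl (k : Type u) {G : Type v} [Field k] [Group G] (g : G) : MonoidAlgebra k G :=
  MonoidAlgebra.single g 1

/-- Conjugation `x ↦ g x g⁻¹` on `kG`. -/
def conj (k : Type u) {G : Type v} [Field k] [Group G] (g : G) :
    MonoidAlgebra k G →ₗ[k] MonoidAlgebra k G :=
  LinearMap.mulLeft k (gl k g) ∘ₗ LinearMap.mulRight k (gl k g⁻¹)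

/-- A left-left Yetter-Drinfeld module structure over the Hopf algebra `kG` on `V`:
a left `kG`-module (given by a representation of `G`), a left `kG`-comodule, and the
compatibility `δ (g · v) = g v₍₋₁₎ g⁻¹ ⊗ g · v₍₀₎`. -/
structure YDModule (k : Type u) (G : Type v) [Field k] [Group G]
    (V : Type w) [AddCommGroup V] [Module k V] where
  act : Representation k G V
  coact : V →ₗ[k] MonoidAlgebra k G ⊗[k] V
  counit_coact : ∀ v, TensorProduct.lid k V
    ((Coalgebra.counit (R := k) (A := MonoidAlgebra k G)).rTensor V (coact v)) = v
  coassoc : ∀ v, TensorProduct.assoc k _ _ V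
    ((Coalgebra.comul (R := k) (A := MonoidAlgebra k G)).rTensor V (coact v)) =
      coact.lTensor (MonoidAlgebra k G) (coact v)
  coact_act : ∀ g v, coact (act g v) = TensorProduct.map (conj k g) (act g) (coact v)

/-- An isomorphism of Yetter-Drinfeld modules: a linear isomorphism which is
`kG`-linear and `kG`-colinear. -/
structure YDIso {V : Type w} [AddCommGroup V] [Module k V] {W : Type w'} [AddCommGroup W]
    [Module k W] (M : YDModule k G V) (N : YDModule k G W) where
  toLinearEquiv : V ≃ₗ[k] W
  map_act : ∀ g v, toLinearEquiv (M.act g v) = N.act g (toLinearEquiv v)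
  map_coact : ∀ v, N.coact (toLinearEquiv v) =
    toLinearEquiv.toLinearMap.lTensor (MonoidAlgebra k G) (M.coact v)

namespace YDModule

variable {V : Type w} [AddCommGroup V] [Module k V] {W : Type w'} [AddCommGroup W] [Module k W]

/-- The Yetter-Drinfeld braiding `c (v ⊗ w) = v₍₋₁₎ · w ⊗ v₍₀₎`. -/
def braiding (M : YDModule k G V) (N : YDModule k G W) : V ⊗[k] W →ₗ[k] W ⊗[k] V :=
  (TensorProduct.lift N.act.asAlgebraHom.toLinearMap).rTensor V ∘ₗ
    (TensorProduct.assoc k (MonoidAlgebra k G) W V).symm.toLinearMap ∘ₗ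
    (TensorProduct.comm k V W).toLinearMap.lTensor (MonoidAlgebra k G) ∘ₗ
    (TensorProduct.assoc k (MonoidAlgebra k G) V W).toLinearMap ∘ₗ
    M.coact.rTensor W

/-- The diagonal coaction `v ⊗ w ↦ v₍₋₁₎ w₍₋₁₎ ⊗ (v₍₀₎ ⊗ w₍₀₎)` on a tensor product. -/
def tensorCoact (M : YDModule k G V) (N : YDModule k G W) :
    V ⊗[k] W →ₗ[k] MonoidAlgebra k G ⊗[k] (V ⊗[k] W) :=
  (LinearMap.mul' k (MonoidAlgebra k G)).rTensor (V ⊗[k] W) ∘ₗ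
    (TensorProduct.tensorTensorTensorComm k (MonoidAlgebra k G) V
      (MonoidAlgebra k G) W).toLinearMap ∘ₗ
    TensorProduct.map M.coact N.coact

/-- `v` is homogeneous of degree `g`. -/
def IsHomog (M : YDModule k G V) (g : G) (v : V) : Prop := M.coact v = gl k g ⊗ₜ v

theorem braiding_homog (M : YDModule k G V) (N : YDModule k G W) {g : G} {v : V}
    (h : M.IsHomog g v) (x : W) : M.braiding N (v ⊗ₜ x) = N.act g x ⊗ₜ v := by
  have h' : M.coact v = gl k g ⊗ₜ v := h
  simp [braiding, h']

theorem tensorCoact_homog (M : YDModule k G V) (N : YDModule k G W) {g h : G} {v : V} {x : W}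
    (hv : M.IsHomog g v) (hx : N.IsHomog h x) :
    M.tensorCoact N (v ⊗ₜ x) = gl k (g * h) ⊗ₜ (v ⊗ₜ x) := by
  have h1 : M.coact v = gl k g ⊗ₜ v := hv
  have h2 : N.coact x = gl k h ⊗ₜ x := hx
  simp [tensorCoact, h1, h2, MonoidAlgebra.single_mul_single]

theorem exists_sum (x : MonoidAlgebra k G ⊗[k] V) :
    ∃ f : G →₀ V, x = f.sum fun g y => gl k g ⊗ₜ y := by
  classical
  induction x using TensorProduct.induction_on with
  | zero => exact ⟨0, by simp⟩
  | tmul a y =>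
    induction a using MonoidAlgebra.induction_linear with
    | zero => exact ⟨0, by simp⟩
    | add a b ha hb =>
      obtain ⟨f, hf⟩ := ha
      obtain ⟨f', hf'⟩ := hb
      refine ⟨f + f', ?_⟩
      rw [TensorProduct.add_tmul, hf, hf', Finsupp.sum_add_index'] <;>
        simp [TensorProduct.tmul_add]
    | single g r =>
      refine ⟨Finsupp.single g (r • y), ?_⟩
      rw [Finsupp.sum_single_index (by simp), ← TensorProduct.smul_tmul]
      simp [gl]
  | add a b ha hb =>
    obtain ⟨f, hf⟩ := ha
    obtain ⟨f', hf'⟩ := hb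
    refine ⟨f + f', ?_⟩
    rw [hf, hf', Finsupp.sum_add_index'] <;> simp [TensorProduct.tmul_add]

/-- The linear map `a ⊗ y ↦ a(g) y`. -/
def coeffAt (k : Type u) {G : Type v} [Field k] [Group G] (V : Type w) [AddCommGroup V]
    [Module k V] (g : G) : MonoidAlgebra k G ⊗[k] V →ₗ[k] V :=
  (TensorProduct.lid k V).toLinearMap ∘ₗ
    (Finsupp.lapply g ∘ₗ (MonoidAlgebra.coeffLinearEquiv k).toLinearMap).rTensor V

open Classical in
theorem coeffAt_gl (g h : G) (y : V) :
    coeffAt k V g (gl k h ⊗ₜ y) = if h = g then y else 0 := by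
  simp [coeffAt, gl, MonoidAlgebra.coeff_single, Finsupp.single_apply]

theorem coeffAt_sum (g : G) (f : G →₀ V) :
    coeffAt k V g (f.sum fun h y => gl k h ⊗ₜ y) = f g := by
  classical
  rw [map_finsuppSum]
  simp only [coeffAt_gl]
  simp only [Finsupp.sum, Finset.sum_ite_eq', Finsupp.mem_support_iff]
  split_ifs with h
  · rfl
  · exact (not_not.mp h).symm

/-- Every element is a sum of homogeneous ones. -/
theorem induction (M : YDModule k G V) {P : V → Prop}
    (homog : ∀ g v, M.IsHomog g v → P v) (zero : P 0) (add : ∀ x y, P x → P y → P (x + y))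
    (v : V) : P v := by
  classical
  obtain ⟨f, hf⟩ := exists_sum (M.coact v)
  have hv : v = f.sum fun _ y => y := by
    have := M.counit_coact v
    rw [hf] at this
    rw [← this]
    simp [map_finsuppSum, gl]
  have key : ∀ g, M.IsHomog g (f g) := by
    intro g
    have := M.coassoc v
    rw [hf] at this
    have h2 := congrArg (coeffAt k _ g) this
    simp only [map_finsuppSum, LinearMap.rTensor_tmul, LinearMap.lTensor_tmul] at h2
    simp only [gl, MonoidAlgebra.comul_single, CommSemiring.comul_apply, TensorProduct.map_tmul,
      MonoidAlgebra.lsingle_apply, TensorProduct.assoc_tmul] at h2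
    have e : ∀ (h : G) {Y : Type (max u v w)} [AddCommGroup Y] [Module k Y] (y : Y),
      coeffAt k Y g (MonoidAlgebra.single h 1 ⊗ₜ y) = if h = g then y else 0 :=
        fun h Y _ _ y => coeffAt_gl g h y
    simp only [e] at h2
    unfold IsHomog
    by_cases hg : f g = 0
    · simp [hg]
    · simpa [Finsupp.sum, hg] using h2.symm
  rw [hv, Finsupp.sum]
  exact Finset.sum_induction _ P add zero fun g _ => homog g _ (key g)

theorem IsHomog.act {M : YDModule k G V} {h : G} {v : V} (hv : M.IsHomog h v) (g : G) :
    M.IsHomog (g * h * g⁻¹) (M.act g v) := by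
  have h1 : M.coact v = gl k h ⊗ₜ v := hv
  simp [IsHomog, M.coact_act, h1, conj, MonoidAlgebra.single_mul_single, mul_assoc]

/-- The Yetter-Drinfeld structure on a submodule stable under action and coaction. -/
def restrict (M : YDModule k G V) (N : Submodule k V) (h1 : ∀ g, ∀ x ∈ N, M.act g x ∈ N)
    (h2 : ∀ x ∈ N, M.coact x ∈ LinearMap.range (N.subtype.lTensor (MonoidAlgebra k G))) :
    YDModule k G N :=
  have inj {A : Type (max u v)} [AddCommGroup A] [Module k A] :
      Function.Injective (N.subtype.lTensor A) :=
    Module.Flat.lTensor_preserves_injective_linearMap _ N.injective_subtype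
  let δ : N →ₗ[k] MonoidAlgebra k G ⊗[k] N :=
    (LinearEquiv.ofInjective (N.subtype.lTensor (MonoidAlgebra k G)) inj).symm.toLinearMap ∘ₗ
      (M.coact ∘ₗ N.subtype).codRestrict _ (fun x => h2 x x.2)
  have hδ : ∀ x : N, N.subtype.lTensor _ (δ x) = M.coact x := fun x =>
    congrArg Subtype.val ((LinearEquiv.ofInjective (N.subtype.lTensor (MonoidAlgebra k G))
      inj).apply_symm_apply ⟨M.coact x, h2 x x.2⟩)
  { act :=
      { toFun := fun g => (M.act g).restrict (h1 g)
        map_one' := by ext; simp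
        map_mul' := by intros; ext; simp }
    coact := δ
    counit_coact := by
      intro x
      apply N.injective_subtype
      have := M.counit_coact x
      rw [← hδ] at this
      refine Eq.trans ?_ this
      generalize δ x = y
      induction y using TensorProduct.induction_on with
      | zero => simp
      | tmul a b => simp
      | add a b ha hb => simp only [map_add, ha, hb]
    coassoc := by
      intro x
      have h3 := M.coassoc x
      rw [← hδ] at h3
      have e1 : N.subtype.lTensor _ ((TensorProduct.assoc k _ _ N).symm
          (δ.lTensor _ (δ x))) = N.subtype.lTensor _
            ((Coalgebra.comul (R := k) (A := MonoidAlgebra k G)).rTensor N (δ x)) := by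
        apply (TensorProduct.assoc k _ _ V).injective
        refine Eq.trans ?_ (h3.symm.trans ?_)
        · have hδ' : ∀ z : MonoidAlgebra k G ⊗[k] N,
            TensorProduct.assoc k _ _ V (N.subtype.lTensor _ ((TensorProduct.assoc k _ _ N).symm
              (δ.lTensor _ z))) = M.coact.lTensor _ (N.subtype.lTensor _ z) := by
            intro z
            induction z using TensorProduct.induction_on with
            | zero => simp
            | add a b ha hb => simp only [map_add, ha, hb]
            | tmul a b =>
              simp only [LinearMap.lTensor_tmul, Submodule.subtype_apply]
              rw [← hδ]
              generalize δ b = y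
              induction y using TensorProduct.induction_on with
              | zero => simp
              | tmul a b => simp
              | add a b ha hb => simp only [map_add, TensorProduct.tmul_add, ha, hb]
          exact hδ' _
        · congr 1
          generalize δ x = y
          induction y using TensorProduct.induction_on with
          | zero => simp
          | tmul a b => simp
          | add a b ha hb => simp only [map_add, ha, hb]
      have e2 := inj e1
      rw [← e2, LinearEquiv.apply_symm_apply]
    coact_act := by
      intro g x
      apply inj
      rw [hδ]
      refine (M.coact_act g x).trans ?_
      rw [← hδ]
      generalize δ x = y
      induction y using TensorProduct.induction_on with
      | zero => simp
      | tmul a b => simp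
      | add a b ha hb => simp only [map_add, ha, hb] }

end YDModule

end YD

/-! ### Graded braided Hopf algebras in the Yetter-Drinfeld category -/

section Hopf

/-- The product `(a ⊗ b)(c ⊗ d) = a (b₍₋₁₎ · c) ⊗ b₍₀₎ d` of the braided tensor square of an
algebra in the Yetter-Drinfeld category. -/
def braidedMul {k : Type u} {G : Type v} [Field k] [Group G] {A : Type w} [Ring A] [Algebra k A]
    (M : YDModule k G A) : (A ⊗[k] A) ⊗[k] (A ⊗[k] A) →ₗ[k] A ⊗[k] A :=
  TensorProduct.map (LinearMap.mul' k A) (LinearMap.mul' k A) ∘ₗ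
    (TensorProduct.assoc k A A (A ⊗[k] A)).symm.toLinearMap ∘ₗ
    ((TensorProduct.assoc k A A A).toLinearMap ∘ₗ (M.braiding M).rTensor A ∘ₗ
      (TensorProduct.assoc k A A A).symm.toLinearMap).lTensor A ∘ₗ
    (TensorProduct.assoc k A A (A ⊗[k] A)).toLinearMap

theorem braidedMul_homog {k : Type u} {G : Type v} [Field k] [Group G] {A : Type w} [Ring A]
    [Algebra k A] (M : YDModule k G A) {g : G} {b : A} (hb : M.IsHomog g b) (a c d : A) :
    braidedMul M ((a ⊗ₜ b) ⊗ₜ (c ⊗ₜ d)) = (a * M.act g c) ⊗ₜ (b * d) := by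
  simp [braidedMul, M.braiding_homog M hb]

/-- An `ℕ`-graded braided Hopf algebra in the category of Yetter-Drinfeld modules over `kG`. -/
structure GradedBraidedHopfAlgebra (k : Type u) (G : Type v) [Field k] [Group G] where
  carrier : Type w
  [ring : Ring carrier]
  [algebra : Algebra k carrier]
  yd : YDModule k G carrier
  comul : carrier →ₗ[k] carrier ⊗[k] carrier
  counit : carrier →ₗ[k] k
  antipode : carrier →ₗ[k] carrier
  deg : ℕ → Submodule k carrier
  -- unit and multiplication are morphisms of Yetter-Drinfeld modules
  act_one : ∀ g, yd.act g 1 = 1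
  act_mul : ∀ g a b, yd.act g (a * b) = yd.act g a * yd.act g b
  coact_one : yd.coact 1 = 1 ⊗ₜ 1
  coact_mul : ∀ a b, yd.coact (a * b) = yd.coact a * yd.coact b
  -- the braided Hopf algebra is a coalgebra
  coassoc : ∀ a, TensorProduct.assoc k carrier carrier carrier (comul.rTensor carrier (comul a)) =
    comul.lTensor carrier (comul a)
  rTensor_counit : ∀ a, TensorProduct.lid k carrier (counit.rTensor carrier (comul a)) = a
  lTensor_counit : ∀ a, TensorProduct.rid k carrier (counit.lTensor carrier (comul a)) = a
  -- comultiplication and counit are morphisms of Yetter-Drinfeld modules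
  comul_act : ∀ g a, comul (yd.act g a) = TensorProduct.map (yd.act g) (yd.act g) (comul a)
  comul_coact : ∀ a, yd.tensorCoact yd (comul a) =
    comul.lTensor (MonoidAlgebra k G) (yd.coact a)
  counit_act : ∀ g a, counit (yd.act g a) = counit a
  counit_coact : ∀ a, counit.lTensor (MonoidAlgebra k G) (yd.coact a) = 1 ⊗ₜ counit a
  -- comultiplication and counit are algebra maps, for the braided tensor square
  comul_one : comul 1 = 1 ⊗ₜ 1
  comul_mul : ∀ a b, comul (a * b) = braidedMul yd (comul a ⊗ₜ comul b)
  counit_one : counit 1 = 1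
  counit_mul : ∀ a b, counit (a * b) = counit a * counit b
  -- the antipode
  antipode_act : ∀ g a, antipode (yd.act g a) = yd.act g (antipode a)
  antipode_coact : ∀ a, yd.coact (antipode a) =
    antipode.lTensor (MonoidAlgebra k G) (yd.coact a)
  mul_antipode_rTensor : ∀ a, LinearMap.mul' k carrier (antipode.rTensor carrier (comul a)) =
    algebraMap k carrier (counit a)
  mul_antipode_lTensor : ∀ a, LinearMap.mul' k carrier (antipode.lTensor carrier (comul a)) =
    algebraMap k carrier (counit a)
  -- the grading
  isInternal : DirectSum.IsInternal deg
  one_mem : 1 ∈ deg 0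
  mul_mem : ∀ m n a b, a ∈ deg m → b ∈ deg n → a * b ∈ deg (m + n)
  act_mem : ∀ n g a, a ∈ deg n → yd.act g a ∈ deg n
  coact_mem : ∀ n a, a ∈ deg n →
    yd.coact a ∈ LinearMap.range ((deg n).subtype.lTensor (MonoidAlgebra k G))
  comul_mem : ∀ n a, a ∈ deg n → comul a ∈ ⨆ p : {p : ℕ × ℕ // p.1 + p.2 = n},
    LinearMap.range (TensorProduct.map (deg p.1.1).subtype (deg p.1.2).subtype)
  counit_deg : ∀ n a, n ≠ 0 → a ∈ deg n → counit a = 0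
  antipode_mem : ∀ n a, a ∈ deg n → antipode a ∈ deg n

attribute [instance] GradedBraidedHopfAlgebra.ring GradedBraidedHopfAlgebra.algebra

/-- An isomorphism of graded braided Hopf algebras in the Yetter-Drinfeld category: an
isomorphism of algebras compatible with all of the structure. -/
structure GradedBraidedHopfIso {k : Type u} {G : Type v} [Field k] [Group G]
    (A : GradedBraidedHopfAlgebra.{u, v, w} k G)
    (B : GradedBraidedHopfAlgebra.{u, v, w'} k G) where
  toAlgEquiv : A.carrier ≃ₐ[k] B.carrier
  map_act : ∀ g a, toAlgEquiv (A.yd.act g a) = B.yd.act g (toAlgEquiv a)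
  map_coact : ∀ a, B.yd.coact (toAlgEquiv a) =
    toAlgEquiv.toLinearMap.lTensor (MonoidAlgebra k G) (A.yd.coact a)
  map_comul : ∀ a, B.comul (toAlgEquiv a) =
    TensorProduct.map toAlgEquiv.toLinearMap toAlgEquiv.toLinearMap (A.comul a)
  map_counit : ∀ a, B.counit (toAlgEquiv a) = A.counit a
  map_antipode : ∀ a, toAlgEquiv (A.antipode a) = B.antipode (toAlgEquiv a)
  map_deg : ∀ n, (A.deg n).map toAlgEquiv.toLinearMap = B.deg n

end Hopf

/-! ### The tensor algebra of a Yetter-Drinfeld module -/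

namespace TA

variable {k : Type u} {G : Type v} [Field k] [Group G] {V : Type w} [AddCommGroup V] [Module k V]

/-- The `ℕ`-grading of the tensor algebra. -/
abbrev grading (k : Type u) [Field k] (V : Type w) [AddCommGroup V] [Module k V] :
    ℕ → Submodule k (TensorAlgebra k V) :=
  fun n => LinearMap.range (TensorAlgebra.ι k : V →ₗ[k] TensorAlgebra k V) ^ n

variable (M : YDModule k G V)

/-- `G` acts on the tensor algebra by algebra maps. -/
def act (g : G) : TensorAlgebra k V →ₐ[k] TensorAlgebra k V :=
  TensorAlgebra.lift k (TensorAlgebra.ι k ∘ₗ M.act g)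

@[simp] theorem act_ι (g : G) (v : V) :
    act M g (TensorAlgebra.ι k v) = TensorAlgebra.ι k (M.act g v) := by simp [act]

/-- The coaction on the tensor algebra is the algebra map extending the one on `V`. -/
def coact : TensorAlgebra k V →ₐ[k] MonoidAlgebra k G ⊗[k] TensorAlgebra k V :=
  TensorAlgebra.lift k ((TensorAlgebra.ι k).lTensor (MonoidAlgebra k G) ∘ₗ M.coact)

@[simp] theorem coact_ι (v : V) : coact M (TensorAlgebra.ι k v) =
    (TensorAlgebra.ι k).lTensor (MonoidAlgebra k G) (M.coact v) := by simp [coact]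

theorem coact_ι_homog {g : G} {v : V} (hv : M.IsHomog g v) : coact M (TensorAlgebra.ι k v) =
    gl k g ⊗ₜ TensorAlgebra.ι k v := by
  have h : M.coact v = gl k g ⊗ₜ v := hv
  simp [h]

/-- Induction on the tensor algebra by multiplying by homogeneous vectors from the left. -/
theorem induction {P : TensorAlgebra k V → Prop} (zero : P 0) (one : P 1)
    (add : ∀ x y, P x → P y → P (x + y)) (smul : ∀ (r : k) x, P x → P (r • x))
    (mul : ∀ g v x, M.IsHomog g v → P x → P (TensorAlgebra.ι k v * x))
    (t : TensorAlgebra k V) : P t := by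
  suffices h : ∀ x, P x → P (t * x) by simpa using h 1 one
  induction t using TensorAlgebra.induction with
  | algebraMap r => intro x hx; rw [← Algebra.smul_def]; exact smul r x hx
  | ι v =>
    intro x hx
    refine M.induction (P := fun v => P (TensorAlgebra.ι k v * x)) (fun g v hv => mul g v x hv hx)
      (by simpa using zero) (fun a b ha hb => ?_) v
    rw [map_add, add_mul]; exact add _ _ ha hb
  | mul a b ha hb => intro x hx; rw [mul_assoc]; exact ha _ (hb _ hx)
  | add a b ha hb => intro x hx; rw [add_mul]; exact add _ _ (ha _ hx) (hb _ hx)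

/-- The Yetter-Drinfeld structure of the tensor algebra. -/
def yd : YDModule k G (TensorAlgebra k V) where
  act :=
    { toFun := fun g => (act M g).toLinearMap
      map_one' := by
        have : act M 1 = AlgHom.id k _ := by ext; simp
        rw [this]; rfl
      map_mul' := fun g h => by
        have : act M (g * h) = (act M g).comp (act M h) := by ext; simp
        rw [this]; rfl }
  coact := (coact M).toLinearMap
  counit_coact t := by
    induction t using induction M with
    | zero => simp
    | one => simp [Algebra.TensorProduct.one_def]
    | add x y hx hy => simp only [map_add, hx, hy]
    | smul r x hx => simp only [map_smul, hx]
    | mul g v x hv hx =>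
      simp only [AlgHom.toLinearMap_apply, map_mul, coact_ι_homog M hv] at hx ⊢
      conv_rhs => rw [← hx]
      generalize coact M x = z
      induction z using TensorProduct.induction_on with
      | zero => simp
      | add a b ha hb => simp only [mul_add, map_add, ha, hb]
      | tmul a b =>
        induction a using MonoidAlgebra.induction_linear with
        | zero => simp
        | add a a' ha hb => simp only [mul_add, TensorProduct.add_tmul, map_add, ha, hb]
        | single g r => simp [gl, MonoidAlgebra.single_mul_single]
  coassoc t := by
    induction t using induction M with
    | zero => simp
    | one =>
      simp [Algebra.TensorProduct.one_def, MonoidAlgebra.one_def]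
    | add x y hx hy => simp only [map_add, hx, hy]
    | smul r x hx => simp only [map_smul, hx]
    | mul g v x hv hx =>
      simp only [AlgHom.toLinearMap_apply, map_mul, coact_ι_homog M hv] at hx ⊢
      have e1 : ∀ z : MonoidAlgebra k G ⊗[k] TensorAlgebra k V,
          TensorProduct.assoc k _ _ (TensorAlgebra k V)
            ((Coalgebra.comul (R := k) (A := MonoidAlgebra k G)).rTensor _
              ((gl k g ⊗ₜ TensorAlgebra.ι k v) * z)) =
          (TensorProduct.map (LinearMap.mulLeft k (gl k g)) (TensorProduct.map
            (LinearMap.mulLeft k (gl k g)) (LinearMap.mulLeft k (TensorAlgebra.ι k v))))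
          (TensorProduct.assoc k _ _ (TensorAlgebra k V)
            ((Coalgebra.comul (R := k) (A := MonoidAlgebra k G)).rTensor _ z)) := by
        intro z
        induction z using TensorProduct.induction_on with
        | zero => simp
        | add a b ha hb => simp only [mul_add, map_add, ha, hb]
        | tmul a b =>
          induction a using MonoidAlgebra.induction_linear with
          | zero => simp
          | add a a' ha hb => simp only [mul_add, TensorProduct.add_tmul, map_add, ha, hb]
          | single g r => simp [gl, MonoidAlgebra.single_mul_single]
      have e2 : ∀ z : MonoidAlgebra k G ⊗[k] TensorAlgebra k V,
          (coact M).toLinearMap.lTensor (MonoidAlgebra k G)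
            ((gl k g ⊗ₜ TensorAlgebra.ι k v) * z) =
          (TensorProduct.map (LinearMap.mulLeft k (gl k g)) (TensorProduct.map
            (LinearMap.mulLeft k (gl k g)) (LinearMap.mulLeft k (TensorAlgebra.ι k v))))
          ((coact M).toLinearMap.lTensor (MonoidAlgebra k G) z) := by
        intro z
        induction z using TensorProduct.induction_on with
        | zero => simp
        | add a b ha hb => simp only [mul_add, map_add, ha, hb]
        | tmul a b =>
          simp only [Algebra.TensorProduct.tmul_mul_tmul, LinearMap.lTensor_tmul,
            AlgHom.toLinearMap_apply, map_mul, coact_ι_homog M hv, TensorProduct.map_tmul,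
            LinearMap.mulLeft_apply]
          generalize coact M b = y
          congr 1
          induction y using TensorProduct.induction_on with
          | zero => simp
          | add a b ha hb => simp only [mul_add, map_add, ha, hb]
          | tmul a b => simp
      rw [e1, e2, hx]
  coact_act g t := by
    induction t using induction M with
    | zero => simp
    | one => simp [Algebra.TensorProduct.one_def, MonoidAlgebra.one_def, conj,
        MonoidAlgebra.single_mul_single]
    | add x y hx hy => simp only [map_add, hx, hy]
    | smul r x hx => simp only [map_smul, hx]
    | mul h v x hv hx =>
      have hx' : coact M (act M g x) =
        TensorProduct.map (conj k g) (act M g).toLinearMap (coact M x) := hx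
      change coact M (act M g (_ * x)) =
        TensorProduct.map (conj k g) (act M g).toLinearMap (coact M (_ * x))
      rw [map_mul, map_mul, map_mul, hx', act_ι, coact_ι_homog M (hv.act g), coact_ι_homog M hv]
      generalize coact M x = z
      induction z using TensorProduct.induction_on with
      | zero => simp
      | add a b ha hb => simp only [mul_add, map_add, ha, hb]
      | tmul a b =>
        induction a using MonoidAlgebra.induction_linear with
        | zero => simp
        | add a a' ha hb => simp only [mul_add, TensorProduct.add_tmul, map_add, ha, hb]
        | single g r => simp [gl, conj, MonoidAlgebra.single_mul_single, mul_assoc]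

theorem yd_act (g : G) (t : TensorAlgebra k V) : (yd M).act g t = act M g t := rfl

theorem yd_coact (t : TensorAlgebra k V) : (yd M).coact t = coact M t := rfl

theorem homog_ι {g : G} {v : V} (hv : M.IsHomog g v) : (yd M).IsHomog g (TensorAlgebra.ι k v) :=
  coact_ι_homog M hv

theorem homog_mul {g h : G} {x y : TensorAlgebra k V} (hx : (yd M).IsHomog g x)
    (hy : (yd M).IsHomog h y) : (yd M).IsHomog (g * h) (x * y) := by
  have h1 : coact M x = gl k g ⊗ₜ x := hx
  have h2 : coact M y = gl k h ⊗ₜ y := hy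
  change coact M (x * y) = _
  simp [h1, h2, MonoidAlgebra.single_mul_single]

theorem homog_one : (yd M).IsHomog 1 (1 : TensorAlgebra k V) := by
  change coact M 1 = _
  simp [Algebra.TensorProduct.one_def, MonoidAlgebra.one_def]

/-- Left multiplication by `v ⊗ 1 + 1 ⊗ v` on the braided tensor square of the tensor algebra. -/
def mulPrimitive : V →ₗ[k] Module.End k (TensorAlgebra k V ⊗[k] TensorAlgebra k V) :=
  TensorProduct.curry (braidedMul (yd M)) ∘ₗ
    ((TensorProduct.mk k (TensorAlgebra k V) (TensorAlgebra k V)).flip 1 +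
      TensorProduct.mk k (TensorAlgebra k V) (TensorAlgebra k V) 1) ∘ₗ TensorAlgebra.ι k

theorem mulPrimitive_homog {g : G} {v : V} (hv : M.IsHomog g v) (x y : TensorAlgebra k V) :
    mulPrimitive M v (x ⊗ₜ y) = (TensorAlgebra.ι k v * x) ⊗ₜ y +
      act M g x ⊗ₜ (TensorAlgebra.ι k v * y) := by
  simp [mulPrimitive, braidedMul_homog _ (homog_one M),
    braidedMul_homog _ (homog_ι M hv), yd_act]

/-- The comultiplication of the tensor algebra: the algebra map to the braided tensor square
with `v ↦ v ⊗ 1 + 1 ⊗ v` on `V`, so that `v₁ ⋯ vₙ` goes to the product of the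
`vᵢ ⊗ 1 + 1 ⊗ vᵢ`. -/
def comul : TensorAlgebra k V →ₗ[k] TensorAlgebra k V ⊗[k] TensorAlgebra k V :=
  (LinearMap.applyₗ (1 ⊗ₜ 1)) ∘ₗ (TensorAlgebra.lift k (mulPrimitive M)).toLinearMap

theorem comul_one : comul M 1 = 1 ⊗ₜ 1 := by simp [comul]

theorem comul_ι_mul (v : V) (t : TensorAlgebra k V) :
    comul M (TensorAlgebra.ι k v * t) = mulPrimitive M v (comul M t) := by simp [comul]

/-- The counit of the tensor algebra. -/
def counit : TensorAlgebra k V →ₐ[k] k := TensorAlgebra.algebraMapInv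

/-- The operator `y ↦ -(v₍₋₁₎ · y) v₍₀₎` on the tensor algebra. -/
def antipodeOp : V →ₗ[k] Module.End k (TensorAlgebra k V) :=
  TensorProduct.curry (-(LinearMap.mul' k (TensorAlgebra k V) ∘ₗ (yd M).braiding (yd M))) ∘ₗ
    TensorAlgebra.ι k

theorem antipodeOp_homog {g : G} {v : V} (hv : M.IsHomog g v) (y : TensorAlgebra k V) :
    antipodeOp M v y = -(act M g y * TensorAlgebra.ι k v) := by
  simp [antipodeOp, YDModule.braiding_homog _ _ (homog_ι M hv), yd_act]

/-- The antipode of the tensor algebra: `S 1 = 1` and `S (v t) = -(v₍₋₁₎ · S t) v₍₀₎`, that is,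
the braided antimultiplicative map with `S v = -v` on `V`. -/
def antipode : TensorAlgebra k V →ₗ[k] TensorAlgebra k V :=
  (LinearMap.applyₗ 1) ∘ₗ (TensorAlgebra.lift k (antipodeOp M)).toLinearMap

theorem antipode_one : antipode M 1 = 1 := by simp [antipode]

theorem antipode_ι_mul (v : V) (t : TensorAlgebra k V) :
    antipode M (TensorAlgebra.ι k v * t) = antipodeOp M v (antipode M t) := by simp [antipode]

end TA

namespace TA

variable {k : Type u} {G : Type v} [Field k] [Group G] {V : Type w} [AddCommGroup V] [Module k V]

theorem tensor_induction (M : YDModule k G V)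
    {P : TensorAlgebra k V ⊗[k] TensorAlgebra k V → Prop} (zero : P 0)
    (add : ∀ x y, P x → P y → P (x + y))
    (tmul : ∀ g h x y, (yd M).IsHomog g x → (yd M).IsHomog h y → P (x ⊗ₜ y))
    (z : TensorAlgebra k V ⊗[k] TensorAlgebra k V) : P z := by
  induction z using TensorProduct.induction_on with
  | zero => exact zero
  | add x y hx hy => exact add x y hx hy
  | tmul x y =>
    refine (yd M).induction (P := fun x => P (x ⊗ₜ y)) (fun g x hx => ?_) (by simpa using zero)
      (fun a b ha hb => by rw [TensorProduct.add_tmul]; exact add _ _ ha hb) x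
    exact (yd M).induction (P := fun y => P (x ⊗ₜ y)) (fun h y hy => tmul g h x y hx hy)
      (by simpa using zero) (fun a b ha hb => by rw [TensorProduct.tmul_add]; exact add _ _ ha hb) y

variable (M : YDModule k G V)

theorem comul_act (h : G) (t : TensorAlgebra k V) : comul M (act M h t) =
    TensorProduct.map (act M h).toLinearMap (act M h).toLinearMap (comul M t) := by
  induction t using induction M with
  | zero => simp
  | one => simp [comul_one]
  | add x y hx hy => simp only [map_add, hx, hy]
  | smul r x hx => simp only [map_smul, hx]
  | mul g v x hv hx =>
    rw [map_mul, act_ι, comul_ι_mul, hx, comul_ι_mul]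
    generalize comul M x = z
    induction z using TensorProduct.induction_on with
    | zero => simp
    | add a b ha hb => simp only [map_add, ha, hb]
    | tmul a b =>
      have e : ∀ g h a, act M g (act M h a) = act M (g * h) a := fun g h a => by
        rw [← yd_act, ← yd_act, ← yd_act, map_mul]; rfl
      simp [mulPrimitive_homog M hv, mulPrimitive_homog M (hv.act h), e]

theorem coassoc (t : TensorAlgebra k V) :
    TensorProduct.assoc k _ _ _ ((comul M).rTensor _ (comul M t)) =
      (comul M).lTensor _ (comul M t) := by
  induction t using induction M with
  | zero => simp
  | one => simp [comul_one]
  | add x y hx hy => simp only [map_add, hx, hy]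
  | smul r x hx => simp only [map_smul, hx]
  | mul g v x hv hx =>
    rw [comul_ι_mul]
    let L3 : TensorAlgebra k V ⊗[k] (TensorAlgebra k V ⊗[k] TensorAlgebra k V) →ₗ[k]
        TensorAlgebra k V ⊗[k] (TensorAlgebra k V ⊗[k] TensorAlgebra k V) :=
      (LinearMap.mulLeft k (TensorAlgebra.ι k v)).rTensor _ +
        TensorProduct.map (act M g).toLinearMap (mulPrimitive M v)
    have e1 : ∀ z, TensorProduct.assoc k _ _ _ ((comul M).rTensor _ (mulPrimitive M v z)) =
        L3 (TensorProduct.assoc k _ _ _ ((comul M).rTensor _ z)) := by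
      intro z
      induction z using TensorProduct.induction_on with
      | zero => simp
      | add a b ha hb => simp only [map_add, ha, hb]
      | tmul a b =>
        simp only [mulPrimitive_homog M hv, map_add, LinearMap.rTensor_tmul, comul_ι_mul, comul_act]
        generalize comul M a = y
        induction y using TensorProduct.induction_on with
        | zero => simp
        | add a b ha hb =>
          simp only [map_add, TensorProduct.add_tmul, ← ha, ← hb]; abel
        | tmul a c =>
          simp [L3, mulPrimitive_homog M hv, TensorProduct.add_tmul, TensorProduct.tmul_add,
            add_assoc]
    have e2 : ∀ z, (comul M).lTensor _ (mulPrimitive M v z) = L3 ((comul M).lTensor _ z) := by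
      intro z
      induction z using TensorProduct.induction_on with
      | zero => simp
      | add a b ha hb => simp only [map_add, ha, hb]
      | tmul a b => simp [L3, mulPrimitive_homog M hv, comul_ι_mul]
    rw [e1, e2, hx]

@[simp] theorem counit_ι (v : V) : counit (TensorAlgebra.ι k v) = 0 := by
  simp [counit, TensorAlgebra.algebraMapInv]

theorem counit_act (g : G) (t : TensorAlgebra k V) : counit (act M g t) = counit t := by
  have : (counit (k := k) (V := V)).comp (act M g) = counit := by
    ext v; simp
  exact DFunLike.congr_fun this t

theorem rTensor_counit (t : TensorAlgebra k V) : TensorProduct.lid k _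
    ((counit (k := k) (V := V)).toLinearMap.rTensor _ (comul M t)) = t := by
  induction t using induction M with
  | zero => simp
  | one => simp [comul_one]
  | add x y hx hy => simp only [map_add, hx, hy]
  | smul r x hx => simp only [map_smul, hx]
  | mul g v x hv hx =>
    rw [comul_ι_mul]
    conv_rhs => rw [← hx]
    generalize comul M x = z
    induction z using TensorProduct.induction_on with
    | zero => simp
    | add a b ha hb => simp only [map_add, mul_add, ha, hb]
    | tmul a b => simp [mulPrimitive_homog M hv, counit_act]

theorem lTensor_counit (t : TensorAlgebra k V) : TensorProduct.rid k _
    ((counit (k := k) (V := V)).toLinearMap.lTensor _ (comul M t)) = t := by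
  induction t using induction M with
  | zero => simp
  | one => simp [comul_one]
  | add x y hx hy => simp only [map_add, hx, hy]
  | smul r x hx => simp only [map_smul, hx]
  | mul g v x hv hx =>
    rw [comul_ι_mul]
    conv_rhs => rw [← hx]
    generalize comul M x = z
    induction z using TensorProduct.induction_on with
    | zero => simp
    | add a b ha hb => simp only [map_add, mul_add, ha, hb]
    | tmul a b => simp [mulPrimitive_homog M hv]

theorem coact_ι_mul {A : Type w'} [AddCommGroup A] [Module k A] (f : TensorAlgebra k V →ₗ[k] A)
    (Φ : A →ₗ[k] A) {g : G} {v : V} (hv : M.IsHomog g v)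
    (hf : ∀ t, f (TensorAlgebra.ι k v * t) = Φ (f t)) (t : TensorAlgebra k V) :
    f.lTensor (MonoidAlgebra k G) (coact M (TensorAlgebra.ι k v * t)) =
      TensorProduct.map (LinearMap.mulLeft k (gl k g)) Φ
        (f.lTensor (MonoidAlgebra k G) (coact M t)) := by
  rw [map_mul, coact_ι_homog M hv]
  generalize coact M t = z
  induction z using TensorProduct.induction_on with
  | zero => simp
  | add a b ha hb => simp only [map_add, mul_add, ha, hb]
  | tmul a b => simp [hf]

theorem comul_coact (t : TensorAlgebra k V) : (yd M).tensorCoact (yd M) (comul M t) =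
    (comul M).lTensor (MonoidAlgebra k G) (coact M t) := by
  induction t using induction M with
  | zero => simp
  | one =>
    rw [comul_one, (yd M).tensorCoact_homog (yd M) (homog_one M) (homog_one M)]
    simp [Algebra.TensorProduct.one_def, MonoidAlgebra.one_def, comul_one]
  | add x y hx hy => simp only [map_add, hx, hy]
  | smul r x hx => simp only [map_smul, hx]
  | mul g v x hv hx =>
    rw [coact_ι_mul M _ _ hv (comul_ι_mul M v), ← hx, comul_ι_mul]
    generalize comul M x = z
    induction z using tensor_induction M with
    | zero => simp
    | add a b ha hb => simp only [map_add, ha, hb]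
    | tmul p q a b ha hb =>
      rw [mulPrimitive_homog M hv, map_add, (yd M).tensorCoact_homog (yd M) ha hb,
        (yd M).tensorCoact_homog (yd M) (homog_mul M (homog_ι M hv) ha) hb]
      have ha' : (yd M).IsHomog _ (act M g a) := ha.act g
      rw [(yd M).tensorCoact_homog (yd M) ha' (homog_mul M (homog_ι M hv) hb)]
      simp [mulPrimitive_homog M hv, TensorProduct.tmul_add, gl,
        MonoidAlgebra.single_mul_single, mul_assoc]

theorem counit_coact (t : TensorAlgebra k V) :
    (counit (k := k) (V := V)).toLinearMap.lTensor (MonoidAlgebra k G) (coact M t) =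
      1 ⊗ₜ counit t := by
  induction t using induction M with
  | zero => simp
  | one => simp [Algebra.TensorProduct.one_def]
  | add x y hx hy => simp only [map_add, TensorProduct.tmul_add, hx, hy]
  | smul r x hx => simp only [map_smul, TensorProduct.tmul_smul, hx]
  | mul g v x hv hx =>
    rw [coact_ι_mul M _ 0 hv (by simp)]
    generalize (counit (k := k) (V := V)).toLinearMap.lTensor (MonoidAlgebra k G) (coact M x) = z
    simp

theorem comul_mul (a b : TensorAlgebra k V) :
    comul M (a * b) = braidedMul (yd M) (comul M a ⊗ₜ comul M b) := by
  induction a using induction M with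
  | zero => simp
  | one =>
    rw [one_mul, comul_one]
    generalize comul M b = z
    induction z using TensorProduct.induction_on with
    | zero => simp
    | add a b ha hb => rw [TensorProduct.tmul_add, map_add, ← ha, ← hb]
    | tmul a b => rw [braidedMul_homog _ (homog_one M)]; simp
  | add x y hx hy => simp only [add_mul, map_add, TensorProduct.add_tmul, hx, hy]
  | smul r x hx => simp only [smul_mul_assoc, map_smul, ← TensorProduct.smul_tmul', hx]
  | mul g v x hv hx =>
    rw [mul_assoc, comul_ι_mul, hx, comul_ι_mul]
    generalize comul M x = y
    generalize comul M b = z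
    induction y using tensor_induction M with
    | zero => simp
    | add a b ha hb => simp only [map_add, TensorProduct.add_tmul, ha, hb]
    | tmul p q a b ha hb =>
      induction z using TensorProduct.induction_on with
      | zero => simp
      | add a b ha hb => simp only [map_add, TensorProduct.tmul_add, ha, hb]
      | tmul c d =>
        rw [braidedMul_homog _ hb, mulPrimitive_homog M hv, mulPrimitive_homog M hv,
          TensorProduct.add_tmul, map_add, braidedMul_homog _ hb,
          braidedMul_homog _ (homog_mul M (homog_ι M hv) hb)]
        have e : ∀ g h a, act M g (act M h a) = act M (g * h) a := fun g h a => by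
          rw [← yd_act, ← yd_act, ← yd_act, map_mul]; rfl
        simp [yd_act, mul_assoc, e]

theorem antipode_act (h : G) (t : TensorAlgebra k V) :
    antipode M (act M h t) = act M h (antipode M t) := by
  induction t using induction M with
  | zero => simp
  | one => simp [antipode_one]
  | add x y hx hy => simp only [map_add, hx, hy]
  | smul r x hx => simp only [map_smul, hx]
  | mul g v x hv hx =>
    have e : ∀ g h a, act M g (act M h a) = act M (g * h) a := fun g h a => by
      rw [← yd_act, ← yd_act, ← yd_act, map_mul]; rfl
    rw [map_mul, act_ι, antipode_ι_mul, hx, antipode_ι_mul, antipodeOp_homog M hv,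
      antipodeOp_homog M (hv.act h)]
    simp [e]

theorem antipode_coact (t : TensorAlgebra k V) :
    coact M (antipode M t) = (antipode M).lTensor (MonoidAlgebra k G) (coact M t) := by
  induction t using induction M with
  | zero => simp
  | one => simp [antipode_one, Algebra.TensorProduct.one_def]
  | add x y hx hy => simp only [map_add, hx, hy]
  | smul r x hx => simp only [map_smul, hx]
  | mul g v x hv hx =>
    rw [coact_ι_mul M _ _ hv (antipode_ι_mul M v), ← hx, antipode_ι_mul]
    generalize antipode M x = y
    induction y using (yd M).induction with
    | zero => simp
    | add a b ha hb => simp only [map_add, ha, hb]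
    | homog p a ha =>
      have ha' : (yd M).IsHomog _ (act M g a) := ha.act g
      have h1 : coact M _ = _ := homog_mul M ha' (homog_ι M hv)
      have h2 : coact M a = gl k p ⊗ₜ a := ha
      rw [antipodeOp_homog M hv, map_neg, h1, h2]
      simp [antipodeOp_homog M hv, MonoidAlgebra.single_mul_single, mul_assoc,
        TensorProduct.tmul_neg]

theorem mul_antipode_rTensor (t : TensorAlgebra k V) :
    LinearMap.mul' k _ ((antipode M).rTensor _ (comul M t)) = algebraMap k _ (counit t) := by
  induction t using induction M with
  | zero => simp
  | one => simp [comul_one, antipode_one]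
  | add x y hx hy => simp only [map_add, hx, hy]
  | smul r x hx =>
    simp only [map_smul, hx, smul_eq_mul]
    rw [map_mul, Algebra.smul_def]
  | mul g v x hv hx =>
    rw [comul_ι_mul]
    generalize comul M x = z
    induction z using TensorProduct.induction_on with
    | zero => simp
    | add a b ha hb => simp only [map_add, ha, hb]; simp
    | tmul a b =>
      simp [mulPrimitive_homog M hv, antipode_ι_mul, antipodeOp_homog M hv, antipode_act, mul_assoc]

theorem mul_antipode_lTensor (t : TensorAlgebra k V) :
    LinearMap.mul' k _ ((antipode M).lTensor _ (comul M t)) = algebraMap k _ (counit t) := by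
  induction t using induction M with
  | zero => simp
  | one => simp [comul_one, antipode_one]
  | add x y hx hy => simp only [map_add, hx, hy]
  | smul r x hx =>
    simp only [map_smul, hx, smul_eq_mul]
    rw [map_mul, Algebra.smul_def]
  | mul g v x hv hx =>
    rw [comul_ι_mul]
    have e : ∀ z, LinearMap.mul' k _ ((antipode M).lTensor _ (mulPrimitive M v z)) =
        TensorAlgebra.ι k v * LinearMap.mul' k _ ((antipode M).lTensor _ z) -
          act M g (LinearMap.mul' k _ ((antipode M).lTensor _ z)) * TensorAlgebra.ι k v := by
      intro z
      induction z using TensorProduct.induction_on with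
      | zero => simp
      | add a b ha hb => simp only [map_add, ha, hb, mul_add, add_mul]; abel
      | tmul a b =>
        simp [mulPrimitive_homog M hv, antipode_ι_mul, antipodeOp_homog M hv, mul_assoc,
          sub_eq_add_neg]
    rw [e, hx]
    simp [Algebra.commutes]

theorem grading_le {Q : ℕ → Submodule k (TensorAlgebra k V)} (one : 1 ∈ Q 0)
    (mul : ∀ n g v x, M.IsHomog g v → x ∈ grading k V n → x ∈ Q n →
      TensorAlgebra.ι k v * x ∈ Q (n + 1)) (n : ℕ) :
    grading k V n ≤ Q n := by
  induction n with
  | zero =>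
    simp only [grading, pow_zero, Submodule.one_le]
    exact one
  | succ n ih =>
    simp only [grading, pow_succ']
    rw [Submodule.mul_le]
    rintro _ ⟨v, rfl⟩ x hx
    refine M.induction (P := fun v => TensorAlgebra.ι k v * x ∈ Q (n + 1))
      (fun g v hv => mul n g v x hv hx (ih hx)) (by simp) (fun a b ha hb => ?_) v
    rw [map_add, add_mul]
    exact add_mem ha hb

theorem ι_mem (v : V) : TensorAlgebra.ι k v ∈ grading k V 1 := by simp [grading]

theorem ι_mul_mem {n : ℕ} (v : V) {x : TensorAlgebra k V} (hx : x ∈ grading k V n) :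
    TensorAlgebra.ι k v * x ∈ grading k V (n + 1) := by
  simp only [grading, pow_succ']
  exact Submodule.mul_mem_mul (LinearMap.mem_range_self _ v) hx

theorem act_mem (n : ℕ) (g : G) (x : TensorAlgebra k V) (hx : x ∈ grading k V n) :
    act M g x ∈ grading k V n := by
  refine grading_le M (Q := fun n => (grading k V n).comap (act M g).toLinearMap) ?_ ?_ n hx
  · simp
  · intro n g v x hv _ hx
    simp only [Submodule.mem_comap, AlgHom.toLinearMap_apply, map_mul, act_ι] at hx ⊢
    exact ι_mul_mem _ hx

theorem coact_mem (n : ℕ) (x : TensorAlgebra k V) (hx : x ∈ grading k V n) :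
    coact M x ∈ LinearMap.range ((grading k V n).subtype.lTensor (MonoidAlgebra k G)) := by
  refine grading_le M (Q := fun n => (LinearMap.range
    ((grading k V n).subtype.lTensor (MonoidAlgebra k G))).comap (coact M).toLinearMap) ?_ ?_ n hx
  · exact ⟨1 ⊗ₜ ⟨1, by simp [grading]⟩, by simp [Algebra.TensorProduct.one_def]⟩
  · intro n g v x hv _ hx
    obtain ⟨z, hz⟩ := hx
    simp only [Submodule.mem_comap, AlgHom.toLinearMap_apply, map_mul,
      coact_ι_homog M hv] at hz ⊢
    rw [← hz]
    clear hz
    induction z using TensorProduct.induction_on with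
    | zero => simp
    | add a b ha hb => rw [map_add, mul_add]; exact add_mem ha hb
    | tmul a b => exact ⟨(gl k g * a) ⊗ₜ ⟨_, ι_mul_mem v b.2⟩, by simp⟩

theorem comul_mem (n : ℕ) (x : TensorAlgebra k V) (hx : x ∈ grading k V n) :
    comul M x ∈ ⨆ p : {p : ℕ × ℕ // p.1 + p.2 = n}, LinearMap.range
      (TensorProduct.map (grading k V p.1.1).subtype (grading k V p.1.2).subtype) := by
  have key : ∀ {n i j : ℕ} (_ : i + j = n) {a b : TensorAlgebra k V}, a ∈ grading k V i →
      b ∈ grading k V j → a ⊗ₜ b ∈ ⨆ p : {p : ℕ × ℕ // p.1 + p.2 = n}, LinearMap.range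
      (TensorProduct.map (grading k V p.1.1).subtype (grading k V p.1.2).subtype) := by
    intro n i j h a b ha hb
    refine Submodule.mem_iSup_of_mem ⟨(i, j), h⟩ ⟨⟨a, ha⟩ ⊗ₜ ⟨b, hb⟩, by simp⟩
  refine grading_le M (Q := fun n => (⨆ p : {p : ℕ × ℕ // p.1 + p.2 = n}, LinearMap.range
    (TensorProduct.map (grading k V p.1.1).subtype (grading k V p.1.2).subtype)).comap
      (comul M)) ?_ ?_ n hx
  · rw [Submodule.mem_comap, comul_one]
    exact key (i := 0) (j := 0) rfl (by simp [grading]) (by simp [grading])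
  · intro n g v x hv _ hx
    rw [Submodule.mem_comap] at hx ⊢
    rw [comul_ι_mul]
    refine Submodule.iSup_induction _ (motive := fun y => mulPrimitive M v y ∈ _) hx ?_ (by simp)
      (fun a b ha hb => by rw [map_add]; exact add_mem ha hb)
    · intro p z hz
      obtain ⟨⟨i, j⟩, rfl⟩ := p
      obtain ⟨z, rfl⟩ := hz
      induction z using TensorProduct.induction_on with
      | zero => simp
      | add a b ha hb => rw [map_add, map_add]; exact add_mem ha hb
      | tmul a b =>
        simp only [TensorProduct.map_tmul, Submodule.subtype_apply, mulPrimitive_homog M hv]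
        exact add_mem (key (by dsimp; omega) (ι_mul_mem v a.2) b.2)
          (key (by dsimp; omega) (act_mem M _ g _ a.2) (ι_mul_mem v b.2))

theorem counit_deg (n : ℕ) (x : TensorAlgebra k V) (hn : n ≠ 0) (hx : x ∈ grading k V n) :
    counit x = 0 := by
  obtain ⟨n, rfl⟩ := Nat.exists_eq_succ_of_ne_zero hn
  simp only [grading, Nat.succ_eq_add_one, pow_succ'] at hx
  induction hx using Submodule.mul_induction_on' with
  | mem_mul_mem a ha b hb => obtain ⟨v, rfl⟩ := ha; simp
  | add a _ b _ ha hb => rw [map_add, ha, hb, add_zero]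

theorem antipode_mem (n : ℕ) (x : TensorAlgebra k V) (hx : x ∈ grading k V n) :
    antipode M x ∈ grading k V n := by
  refine grading_le M (Q := fun n => (grading k V n).comap (antipode M)) ?_ ?_ n hx
  · simp [antipode_one]
  · intro n g v x hv _ hx
    rw [Submodule.mem_comap] at hx ⊢
    rw [antipode_ι_mul, antipodeOp_homog M hv]
    simp only [grading, pow_succ]
    exact neg_mem (Submodule.mul_mem_mul (act_mem M n g _ hx) (LinearMap.mem_range_self _ v))

end TA

/-- The tensor algebra of a Yetter-Drinfeld module as a graded braided Hopf algebra. -/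
def tensorHopf {k : Type u} {G : Type v} [Field k] [Group G] {V : Type w} [AddCommGroup V]
    [Module k V] (M : YDModule k G V) : GradedBraidedHopfAlgebra.{u, v, max u w} k G where
  carrier := TensorAlgebra k V
  yd := TA.yd M
  comul := TA.comul M
  counit := TA.counit.toLinearMap
  antipode := TA.antipode M
  deg := TA.grading k V
  act_one g := map_one (TA.act M g)
  act_mul g := map_mul (TA.act M g)
  coact_one := map_one (TA.coact M)
  coact_mul := map_mul (TA.coact M)
  coassoc := TA.coassoc M
  rTensor_counit := TA.rTensor_counit M
  lTensor_counit := TA.lTensor_counit M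
  comul_act := TA.comul_act M
  comul_coact := TA.comul_coact M
  counit_act := TA.counit_act M
  counit_coact := TA.counit_coact M
  comul_one := TA.comul_one M
  comul_mul := TA.comul_mul M
  counit_one := map_one TA.counit
  counit_mul := map_mul TA.counit
  antipode_act := TA.antipode_act M
  antipode_coact := TA.antipode_coact M
  mul_antipode_rTensor := TA.mul_antipode_rTensor M
  mul_antipode_lTensor := TA.mul_antipode_lTensor M
  isInternal := DirectSum.Decomposition.isInternal _
  one_mem := by simp [TA.grading]
  mul_mem m n a b ha hb := by
    simp only [TA.grading, pow_add]
    exact Submodule.mul_mem_mul ha hb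
  act_mem := TA.act_mem M
  coact_mem := TA.coact_mem M
  comul_mem := TA.comul_mem M
  counit_deg := TA.counit_deg
  antipode_mem := TA.antipode_mem M

/-! ### Hopf ideals, quotients and Nichols algebras -/

section Quotient

variable {k : Type u} {G : Type v} [Field k] [Group G]

/-- A homogeneous Hopf ideal of a graded braided Hopf algebra: a homogeneous two-sided ideal
which is also a coideal, a Yetter-Drinfeld submodule, and stable under the antipode. -/
structure IsHopfIdeal (H : GradedBraidedHopfAlgebra.{u, v, w} k G) (J : Ideal H.carrier) :
    Prop where
  twoSided : J.IsTwoSided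
  homogeneous : J.restrictScalars k ≤ ⨆ n, J.restrictScalars k ⊓ H.deg n
  act_mem : ∀ g, ∀ a ∈ J, H.yd.act g a ∈ J
  coact_mem : ∀ a ∈ J, H.yd.coact a ∈
    LinearMap.range ((J.restrictScalars k).subtype.lTensor (MonoidAlgebra k G))
  comul_mem : ∀ a ∈ J, H.comul a ∈
    LinearMap.range ((J.restrictScalars k).subtype.rTensor H.carrier) ⊔
      LinearMap.range ((J.restrictScalars k).subtype.lTensor H.carrier)
  counit_mem : ∀ a ∈ J, H.counit a = 0
  antipode_mem : ∀ a ∈ J, H.antipode a ∈ J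

theorem range_lTensor_mono {A B : Type*} [AddCommGroup A] [Module k A] [AddCommGroup B]
    [Module k B] {p q : Submodule k A} (h : p ≤ q) :
    LinearMap.range (p.subtype.lTensor B) ≤ LinearMap.range (q.subtype.lTensor B) := by
  have : p.subtype = q.subtype ∘ₗ Submodule.inclusion h := by ext; rfl
  rw [this, LinearMap.lTensor_comp]
  exact LinearMap.range_comp_le_range _ _

theorem range_rTensor_mono {A B : Type*} [AddCommGroup A] [Module k A] [AddCommGroup B]
    [Module k B] {p q : Submodule k A} (h : p ≤ q) :
    LinearMap.range (p.subtype.rTensor B) ≤ LinearMap.range (q.subtype.rTensor B) := by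
  have : p.subtype = q.subtype ∘ₗ Submodule.inclusion h := by ext; rfl
  rw [this, LinearMap.rTensor_comp]
  exact LinearMap.range_comp_le_range _ _

/-- A sum of homogeneous Hopf ideals is a homogeneous Hopf ideal. -/
theorem isHopfIdeal_sSup {H : GradedBraidedHopfAlgebra.{u, v, w} k G} {S : Set (Ideal H.carrier)}
    (hS : ∀ J ∈ S, IsHopfIdeal H J) : IsHopfIdeal H (sSup S) := by
  have ind {P : H.carrier → Prop} (h : ∀ J ∈ S, ∀ a ∈ J, P a) (h0 : P 0)
      (ha : ∀ a b, P a → P b → P (a + b)) : ∀ a ∈ sSup S, P a := by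
    intro a hx
    rw [sSup_eq_iSup'] at hx
    exact Submodule.iSup_induction _ (motive := P) hx (fun J x hx => h J J.2 x hx) h0 ha
  have le {J} (hJ : J ∈ S) : J.restrictScalars k ≤ (sSup S).restrictScalars k :=
    fun a ha => le_sSup hJ ha
  refine ⟨⟨fun b ha => ?_⟩, ?_, ?_, ?_, ?_, ?_, ?_⟩
  · refine ind (P := fun a => a * b ∈ sSup S) (fun J hJ a ha => le_sSup hJ ?_) (by simp)
      (fun a c ha hc => by rw [add_mul]; exact add_mem ha hc) _ ha
    exact (hS J hJ).twoSided.mul_mem_of_left b ha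
  · refine ind (fun J hJ a ha => ?_) (zero_mem _) (fun _ _ => add_mem)
    exact iSup_mono (fun n => inf_le_inf_right _ (le hJ)) ((hS J hJ).homogeneous ha)
  · exact fun g => ind (fun J hJ a ha => le_sSup hJ ((hS J hJ).act_mem g a ha)) (by simp)
      (fun a b ha hb => by rw [map_add]; exact add_mem ha hb)
  · refine ind (fun J hJ a ha => range_lTensor_mono (le hJ) ((hS J hJ).coact_mem a ha)) (by simp)
      (fun a b ha hb => by rw [map_add]; exact add_mem ha hb)
  · refine ind (fun J hJ a ha => ?_) (by simp)
      (fun a b ha hb => by rw [map_add]; exact add_mem ha hb)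
    exact sup_le_sup (range_rTensor_mono (le hJ)) (range_lTensor_mono (le hJ))
      ((hS J hJ).comul_mem a ha)
  · exact ind (fun J hJ => (hS J hJ).counit_mem) (by simp)
      (fun a b ha hb => by rw [map_add, ha, hb, add_zero])
  · exact ind (fun J hJ a ha => le_sSup hJ ((hS J hJ).antipode_mem a ha)) (by simp)
      (fun a b ha hb => by rw [map_add]; exact add_mem ha hb)

namespace IsHopfIdeal

variable {H : GradedBraidedHopfAlgebra.{u, v, w} k G} {J : Ideal H.carrier}

/-- The descent of a linear map to the quotient by `J`. -/
def desc (J : Ideal H.carrier) {A : Type*} [AddCommGroup A] [Module k A]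
    (f : H.carrier →ₗ[k] A) (hf : ∀ a ∈ J, f a = 0) : (H.carrier ⧸ J) →ₗ[k] A :=
  (J.restrictScalars k).liftQ f (fun a ha => hf a ha)

/-- The projection to the quotient by `J`, as a linear map. -/
def proj (J : Ideal H.carrier) : H.carrier →ₗ[k] H.carrier ⧸ J := (J.restrictScalars k).mkQ

theorem desc_proj {A : Type*} [AddCommGroup A] [Module k A]
    (f : H.carrier →ₗ[k] A) (hf : ∀ a ∈ J, f a = 0) (a : H.carrier) :
    desc J f hf (proj J a) = f a := rfl

theorem proj_surjective : Function.Surjective (proj J) := Submodule.mkQ_surjective _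

theorem proj_eq_zero {a : H.carrier} : proj J a = 0 ↔ a ∈ J :=
  Submodule.Quotient.mk_eq_zero (J.restrictScalars k)

theorem proj_comp_subtype : proj J ∘ₗ (J.restrictScalars k).subtype = 0 := by
  ext x; exact proj_eq_zero.mpr x.2

theorem lTensor_coact (hJ : IsHopfIdeal H J) (a : H.carrier) (ha : a ∈ J) :
    ((proj J).lTensor (MonoidAlgebra k G) ∘ₗ H.yd.coact) a = 0 := by
  obtain ⟨z, hz⟩ := hJ.coact_mem a ha
  rw [LinearMap.comp_apply, ← hz, ← LinearMap.comp_apply, ← LinearMap.lTensor_comp,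
    proj_comp_subtype, LinearMap.lTensor_zero, LinearMap.zero_apply]

theorem map_comul (hJ : IsHopfIdeal H J) (a : H.carrier) (ha : a ∈ J) :
    (TensorProduct.map (proj J) (proj J) ∘ₗ H.comul) a = 0 := by
  obtain ⟨_, ⟨x, rfl⟩, _, ⟨y, rfl⟩, h⟩ := Submodule.mem_sup.mp (hJ.comul_mem a ha)
  rw [LinearMap.comp_apply, ← h, map_add, ← LinearMap.comp_apply, ← LinearMap.comp_apply,
    LinearMap.map_comp_rTensor, LinearMap.map_comp_lTensor, proj_comp_subtype]
  simp

theorem proj_act (hJ : IsHopfIdeal H J) (g : G) (a : H.carrier) (ha : a ∈ J) : (proj J ∘ₗ H.yd.act g) a = 0 :=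
  proj_eq_zero.mpr (hJ.act_mem g a ha)

theorem proj_antipode (hJ : IsHopfIdeal H J) (a : H.carrier) (ha : a ∈ J) : (proj J ∘ₗ H.antipode) a = 0 :=
  proj_eq_zero.mpr (hJ.antipode_mem a ha)

/-- The Yetter-Drinfeld structure of the quotient. -/
def quotientYD (hJ : IsHopfIdeal H J) : YDModule k G (H.carrier ⧸ J) where
  act :=
    { toFun := fun g => desc J (proj J ∘ₗ H.yd.act g) (hJ.proj_act g)
      map_one' := by
        refine LinearMap.ext fun x => ?_
        obtain ⟨a, rfl⟩ := proj_surjective x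
        simp [desc_proj]
      map_mul' := fun g h => by
        refine LinearMap.ext fun x => ?_
        obtain ⟨a, rfl⟩ := proj_surjective x
        simp [desc_proj] }
  coact := desc J ((proj J).lTensor (MonoidAlgebra k G) ∘ₗ H.yd.coact) hJ.lTensor_coact
  counit_coact x := by
    obtain ⟨a, rfl⟩ := proj_surjective x
    rw [desc_proj]
    conv_rhs => rw [← H.yd.counit_coact a]
    rw [LinearMap.comp_apply]
    generalize H.yd.coact a = z
    induction z using TensorProduct.induction_on with
    | zero => simp
    | add a b ha hb => simp only [map_add, ha, hb]
    | tmul a b => simp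
  coassoc x := by
    obtain ⟨a, rfl⟩ := proj_surjective x
    rw [desc_proj]
    rw [LinearMap.comp_apply]
    have e1 : ∀ z, TensorProduct.assoc k _ _ _
        ((Coalgebra.comul (R := k) (A := MonoidAlgebra k G)).rTensor _
          ((proj J).lTensor (MonoidAlgebra k G) z)) =
        ((proj J).lTensor (MonoidAlgebra k G)).lTensor (MonoidAlgebra k G)
        (TensorProduct.assoc k _ _ _
          ((Coalgebra.comul (R := k) (A := MonoidAlgebra k G)).rTensor _ z)) := by
      intro z
      induction z using TensorProduct.induction_on with
      | zero => simp
      | add a b ha hb => simp only [map_add, ha, hb]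
      | tmul a b =>
        simp only [LinearMap.lTensor_tmul, LinearMap.rTensor_tmul]
        generalize CoalgebraStruct.comul (R := k) a = y
        induction y using TensorProduct.induction_on with
        | zero => simp
        | add a b ha hb => simp only [map_add, TensorProduct.add_tmul, ha, hb]
        | tmul a b => simp
    rw [e1, H.yd.coassoc]
    generalize H.yd.coact a = z
    induction z using TensorProduct.induction_on with
    | zero => simp
    | add a b ha hb => simp only [map_add, ha, hb]
    | tmul a b => simp [desc_proj]
  coact_act g x := by
    obtain ⟨a, rfl⟩ := proj_surjective x
    change desc J _ _ (desc J _ _ (proj J a)) = TensorProduct.map _ (desc J _ _) (desc J _ _ _)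
    simp only [desc_proj, LinearMap.comp_apply, H.yd.coact_act]
    generalize H.yd.coact a = z
    induction z using TensorProduct.induction_on with
    | zero => simp
    | add a b ha hb => simp only [map_add, ha, hb]
    | tmul a b => simp [desc_proj]

theorem act_proj (hJ : IsHopfIdeal H J) (g : G) (a : H.carrier) :
    hJ.quotientYD.act g (proj J a) = proj J (H.yd.act g a) := rfl

theorem coact_proj (hJ : IsHopfIdeal H J) (a : H.carrier) :
    hJ.quotientYD.coact (proj J a) = (proj J).lTensor (MonoidAlgebra k G) (H.yd.coact a) := rfl

theorem homog_proj (hJ : IsHopfIdeal H J) {g : G} {a : H.carrier} (h : H.yd.IsHomog g a) :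
    hJ.quotientYD.IsHomog g (proj J a) := by
  have h' : H.yd.coact a = gl k g ⊗ₜ a := h
  change hJ.quotientYD.coact (proj J a) = _
  simp [coact_proj, h']

theorem tensorCoact_proj (hJ : IsHopfIdeal H J) (z : H.carrier ⊗[k] H.carrier) :
    hJ.quotientYD.tensorCoact hJ.quotientYD (TensorProduct.map (proj J) (proj J) z) =
      (TensorProduct.map (proj J) (proj J)).lTensor (MonoidAlgebra k G)
        (H.yd.tensorCoact H.yd z) := by
  induction z using TensorProduct.induction_on with
  | zero => simp
  | add a b ha hb => simp only [map_add, ha, hb]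
  | tmul a b =>
    simp only [TensorProduct.map_tmul, YDModule.tensorCoact, LinearMap.comp_apply, coact_proj]
    generalize H.yd.coact a = x
    generalize H.yd.coact b = y
    induction x using TensorProduct.induction_on with
    | zero => simp
    | add a b ha hb => simp only [map_add, TensorProduct.add_tmul, ha, hb]
    | tmul a a' =>
      induction y using TensorProduct.induction_on with
      | zero => simp
      | add a b ha hb => simp only [map_add, TensorProduct.tmul_add, ha, hb]
      | tmul b b' => simp

/-- The quotient of a graded braided Hopf algebra by a homogeneous Hopf ideal. -/
def quotient (hJ : IsHopfIdeal H J) : GradedBraidedHopfAlgebra.{u, v, w} k G :=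
  haveI := hJ.twoSided
  have proj_mul : ∀ a b, proj J (a * b) = proj J a * proj J b := fun _ _ => rfl
  have proj_one : proj J 1 = 1 := rfl
  let Δ : (H.carrier ⧸ J) →ₗ[k] (H.carrier ⧸ J) ⊗[k] (H.carrier ⧸ J) :=
    desc J (TensorProduct.map (proj J) (proj J) ∘ₗ H.comul) hJ.map_comul
  let ε : (H.carrier ⧸ J) →ₗ[k] k := desc J H.counit hJ.counit_mem
  let S : (H.carrier ⧸ J) →ₗ[k] (H.carrier ⧸ J) := desc J (proj J ∘ₗ H.antipode) hJ.proj_antipode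
  have hΔ : ∀ a, Δ (proj J a) = TensorProduct.map (proj J) (proj J) (H.comul a) := fun _ => rfl
  have hε : ∀ a, ε (proj J a) = H.counit a := fun _ => rfl
  have hS : ∀ a, S (proj J a) = proj J (H.antipode a) := fun _ => rfl
  { carrier := H.carrier ⧸ J
    yd := hJ.quotientYD
    comul := Δ
    counit := ε
    antipode := S
    deg := fun n => (H.deg n).map (proj J)
    act_one := fun g => by
      rw [← proj_one, act_proj, H.act_one]
    act_mul := fun g x y => by
      obtain ⟨a, rfl⟩ := proj_surjective x
      obtain ⟨b, rfl⟩ := proj_surjective y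
      rw [← proj_mul, act_proj, act_proj, act_proj, H.act_mul, proj_mul]
    coact_one := by
      rw [← proj_one, coact_proj, H.coact_one]; rfl
    coact_mul := fun x y => by
      obtain ⟨a, rfl⟩ := proj_surjective x
      obtain ⟨b, rfl⟩ := proj_surjective y
      rw [← proj_mul, coact_proj, coact_proj, coact_proj, H.coact_mul]
      generalize H.yd.coact a = x
      generalize H.yd.coact b = y
      induction x using TensorProduct.induction_on with
      | zero => simp
      | add a b ha hb => simp only [map_add, add_mul, ha, hb]
      | tmul a a' =>
        induction y using TensorProduct.induction_on with
        | zero => simp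
        | add a b ha hb => simp only [map_add, mul_add, ha, hb]
        | tmul b b' => simp [proj_mul]
    coassoc := fun x => by
      obtain ⟨a, rfl⟩ := proj_surjective x
      rw [hΔ]
      have e1 : ∀ z, TensorProduct.assoc k _ _ _
          (Δ.rTensor _ (TensorProduct.map (proj J) (proj J) z)) =
          TensorProduct.map (proj J) (TensorProduct.map (proj J) (proj J))
            (TensorProduct.assoc k _ _ _ (H.comul.rTensor _ z)) := by
        intro z
        induction z using TensorProduct.induction_on with
        | zero => simp
        | add a b ha hb => simp only [map_add, ha, hb]
        | tmul a b =>
          simp only [TensorProduct.map_tmul, LinearMap.rTensor_tmul, hΔ]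
          generalize H.comul a = y
          induction y using TensorProduct.induction_on with
          | zero => simp
          | add a b ha hb => simp only [map_add, TensorProduct.add_tmul, ha, hb]
          | tmul a b => simp
      rw [e1, H.coassoc]
      generalize H.comul a = z
      induction z using TensorProduct.induction_on with
      | zero => simp
      | add a b ha hb => simp only [map_add, ha, hb]
      | tmul a b => simp [hΔ]
    rTensor_counit := fun x => by
      obtain ⟨a, rfl⟩ := proj_surjective x
      conv_rhs => rw [← H.rTensor_counit a]
      rw [hΔ]
      generalize H.comul a = z
      induction z using TensorProduct.induction_on with
      | zero => simp
      | add a b ha hb => simp only [map_add, ha, hb]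
      | tmul a b => simp [hε]
    lTensor_counit := fun x => by
      obtain ⟨a, rfl⟩ := proj_surjective x
      conv_rhs => rw [← H.lTensor_counit a]
      rw [hΔ]
      generalize H.comul a = z
      induction z using TensorProduct.induction_on with
      | zero => simp
      | add a b ha hb => simp only [map_add, ha, hb]
      | tmul a b => simp [hε]
    comul_act := fun g x => by
      obtain ⟨a, rfl⟩ := proj_surjective x
      rw [act_proj, hΔ, hΔ, H.comul_act]
      generalize H.comul a = z
      induction z using TensorProduct.induction_on with
      | zero => simp
      | add a b ha hb => simp only [map_add, ha, hb]
      | tmul a b => simp [act_proj]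
    comul_coact := fun x => by
      obtain ⟨a, rfl⟩ := proj_surjective x
      rw [hΔ, tensorCoact_proj, H.comul_coact, coact_proj]
      generalize H.yd.coact a = z
      induction z using TensorProduct.induction_on with
      | zero => simp
      | add a b ha hb => simp only [map_add, ha, hb]
      | tmul a b => simp [hΔ]
    counit_act := fun g x => by
      obtain ⟨a, rfl⟩ := proj_surjective x
      rw [act_proj, hε, hε, H.counit_act]
    counit_coact := fun x => by
      obtain ⟨a, rfl⟩ := proj_surjective x
      rw [hε, ← H.counit_coact, coact_proj]
      generalize H.yd.coact a = z
      induction z using TensorProduct.induction_on with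
      | zero => simp
      | add a b ha hb => simp only [map_add, ha, hb]
      | tmul a b => simp [hε]
    comul_one := by rw [← proj_one, hΔ, H.comul_one]; rfl
    comul_mul := fun x y => by
      obtain ⟨a, rfl⟩ := proj_surjective x
      obtain ⟨b, rfl⟩ := proj_surjective y
      rw [← proj_mul, hΔ, hΔ, hΔ, H.comul_mul]
      generalize H.comul a = x
      generalize H.comul b = y
      induction x using TensorProduct.induction_on with
      | zero => simp
      | add a b ha hb => simp only [map_add, TensorProduct.add_tmul, ha, hb]
      | tmul a a' =>
        induction y using TensorProduct.induction_on with
        | zero => simp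
        | add a b ha hb => simp only [map_add, TensorProduct.tmul_add, ha, hb]
        | tmul b b' =>
          induction a' using H.yd.induction with
          | zero => simp
          | add a b ha hb => simp only [map_add, TensorProduct.add_tmul,
              TensorProduct.tmul_add, ha, hb]
          | homog g c hc =>
            rw [braidedMul_homog _ hc, TensorProduct.map_tmul, TensorProduct.map_tmul,
              TensorProduct.map_tmul, braidedMul_homog _ (hJ.homog_proj hc), proj_mul, proj_mul,
              act_proj]
    counit_one := by rw [← proj_one, hε, H.counit_one]
    counit_mul := fun x y => by
      obtain ⟨a, rfl⟩ := proj_surjective x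
      obtain ⟨b, rfl⟩ := proj_surjective y
      rw [← proj_mul, hε, hε, hε, H.counit_mul]
    antipode_act := fun g x => by
      obtain ⟨a, rfl⟩ := proj_surjective x
      rw [act_proj, hS, hS, H.antipode_act, act_proj]
    antipode_coact := fun x => by
      obtain ⟨a, rfl⟩ := proj_surjective x
      rw [hS, coact_proj, coact_proj, H.antipode_coact]
      generalize H.yd.coact a = z
      induction z using TensorProduct.induction_on with
      | zero => simp
      | add a b ha hb => simp only [map_add, ha, hb]
      | tmul a b => simp [hS]
    mul_antipode_rTensor := fun x => by
      obtain ⟨a, rfl⟩ := proj_surjective x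
      have e : algebraMap k (H.carrier ⧸ J) (H.counit a) =
        proj J (algebraMap k H.carrier (H.counit a)) := rfl
      rw [hε, e, hΔ, ← H.mul_antipode_rTensor]
      generalize H.comul a = z
      induction z using TensorProduct.induction_on with
      | zero => simp
      | add a b ha hb => simp only [map_add, ha, hb]
      | tmul a b => simp [hS, proj_mul]
    mul_antipode_lTensor := fun x => by
      obtain ⟨a, rfl⟩ := proj_surjective x
      have e : algebraMap k (H.carrier ⧸ J) (H.counit a) =
        proj J (algebraMap k H.carrier (H.counit a)) := rfl
      rw [hε, e, hΔ, ← H.mul_antipode_lTensor]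
      generalize H.comul a = z
      induction z using TensorProduct.induction_on with
      | zero => simp
      | add a b ha hb => simp only [map_add, ha, hb]
      | tmul a b => simp [hS, proj_mul]
    isInternal := by
      classical
      rw [DirectSum.isInternal_submodule_iff_iSupIndep_and_iSup_eq_top]
      have hH := H.isInternal
      have hH' := (DirectSum.isInternal_submodule_iff_iSupIndep_and_iSup_eq_top _).mp hH
      constructor
      · rw [iSupIndep_def]
        intro n
        rw [Submodule.disjoint_def]
        rintro _ ⟨a, ha, rfl⟩ hx
        simp only [← Submodule.map_iSup] at hx
        obtain ⟨b, hb, hab⟩ := hx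
        have hJab : a - b ∈ J := by rw [← proj_eq_zero, map_sub, hab, sub_self]
        have hsplit : (⨆ m, J.restrictScalars k ⊓ H.deg m) ≤
            (J.restrictScalars k ⊓ H.deg n) ⊔ ⨆ m, ⨆ (_ : m ≠ n), H.deg m := by
          refine iSup_le fun m => ?_
          by_cases hm : m = n
          · subst hm; exact le_sup_left
          · exact (inf_le_right.trans (le_iSup₂ (f := fun m (_ : m ≠ n) => H.deg m) m hm)).trans le_sup_right
        obtain ⟨c, hc, d, hd, hcd⟩ := Submodule.mem_sup.mp (hsplit (hJ.homogeneous hJab))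
        have hac : a - c = b + d := by
          have : a = c + d + b := by rw [hcd]; abel
          rw [this]; abel
        have h0 : a - c = 0 := by
          refine Submodule.disjoint_def.mp (iSupIndep_def.mp hH'.1 n) _
            (sub_mem ha hc.2) ?_
          rw [hac]
          exact add_mem hb hd
        rw [proj_eq_zero, sub_eq_zero.mp h0]
        exact hc.1
      · rw [← Submodule.map_iSup, hH'.2, Submodule.map_top]
        exact LinearMap.range_eq_top.mpr proj_surjective
    one_mem := ⟨1, H.one_mem, rfl⟩
    mul_mem := by
      rintro m n _ _ ⟨a, ha, rfl⟩ ⟨b, hb, rfl⟩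
      exact ⟨a * b, H.mul_mem m n a b ha hb, rfl⟩
    act_mem := by
      rintro n g _ ⟨a, ha, rfl⟩
      exact ⟨_, H.act_mem n g a ha, rfl⟩
    coact_mem := by
      rintro n _ ⟨a, ha, rfl⟩
      rw [coact_proj]
      obtain ⟨z, hz⟩ := H.coact_mem n a ha
      rw [← hz]
      clear hz
      induction z using TensorProduct.induction_on with
      | zero => simp
      | add a b ha hb => rw [map_add, map_add]; exact add_mem ha hb
      | tmul a b => exact ⟨a ⊗ₜ ⟨_, b, b.2, rfl⟩, by simp⟩
    comul_mem := by
      rintro n _ ⟨a, ha, rfl⟩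
      rw [hΔ]
      refine Submodule.iSup_induction _ (motive := fun y =>
        TensorProduct.map (proj J) (proj J) y ∈ _) (H.comul_mem n a ha) ?_ (by simp)
        (fun a b ha hb => by rw [map_add]; exact add_mem ha hb)
      rintro p _ ⟨z, rfl⟩
      refine Submodule.mem_iSup_of_mem p ?_
      induction z using TensorProduct.induction_on with
      | zero => simp
      | add a b ha hb => rw [map_add, map_add]; exact add_mem ha hb
      | tmul a b => exact ⟨⟨_, a, a.2, rfl⟩ ⊗ₜ ⟨_, b, b.2, rfl⟩, by simp⟩
    counit_deg := by
      rintro n _ hn ⟨a, ha, rfl⟩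
      exact H.counit_deg n a hn ha
    antipode_mem := by
      rintro n _ ⟨a, ha, rfl⟩
      exact ⟨_, H.antipode_mem n a ha, rfl⟩ }

end IsHopfIdeal

variable {V : Type w} [AddCommGroup V] [Module k V]

/-- The defining ideal of the Nichols algebra: the sum (that is, the largest) of all
homogeneous Hopf ideals of the tensor algebra which lie in degrees at least two. -/
def nicholsIdeal (M : YDModule k G V) : Ideal (tensorHopf M).carrier :=
  sSup {J | IsHopfIdeal (tensorHopf M) J ∧
    J.restrictScalars k ≤ ⨆ n : ℕ, (tensorHopf M).deg (n + 2)}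

theorem nicholsIdeal_isHopfIdeal (M : YDModule k G V) :
    IsHopfIdeal (tensorHopf M) (nicholsIdeal M) :=
  isHopfIdeal_sSup fun _ hJ => hJ.1

/-- The Nichols algebra of a Yetter-Drinfeld module. -/
def nicholsAlgebra (M : YDModule k G V) : GradedBraidedHopfAlgebra.{u, v, max u w} k G :=
  (nicholsIdeal_isHopfIdeal M).quotient

end Quotient

/-! ### The Yetter-Drinfeld module of a conjugacy class and a centralizer representation -/

section ClassModule

variable {k : Type u} {G : Type v} [Field k] [Group G]

/-- Extensionality by basis vectors, for checking Yetter-Drinfeld axioms on a free module. -/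
theorem finsupp_ind {ι : Type*} {V : Type*} [AddCommGroup V] {P : (ι →₀ V) → Prop} (zero : P 0)
    (add : ∀ x y, P x → P y → P (x + y)) (single : ∀ i v, P (Finsupp.single i v))
    (x : ι →₀ V) : P x := by
  induction x using Finsupp.induction_linear with
  | zero => exact zero
  | add x y hx hy => exact add x y hx hy
  | single i v => exact single i v

variable {s : G}

/-- A choice of elements `g t` with `g t * s * (g t)⁻¹ = t`, for `t` in the conjugacy class
of `s`. -/
structure ClassReps (s : G) where
  g : conjugatesOf s → G
  conj_eq : ∀ t, g t * s * (g t)⁻¹ = t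

instance (s : G) : Nonempty (ClassReps s) :=
  have h : ∀ t : conjugatesOf s, ∃ g : G, g * s * g⁻¹ = t := fun t =>
    isConj_iff.mp (show IsConj s t from t.2)
  ⟨⟨fun t => (h t).choose, fun t => (h t).choose_spec⟩⟩

/-- The element `h t h⁻¹` of the conjugacy class. -/
def classConj (h : G) (t : conjugatesOf s) : conjugatesOf s :=
  ⟨h * t * h⁻¹, IsConj.trans (show IsConj s t from t.2) (isConj_iff.mpr ⟨h, rfl⟩)⟩

theorem conj_aux {a b s : G} (h : a * s * a⁻¹ = b * s * b⁻¹) :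
    a⁻¹ * b * s = s * (a⁻¹ * b) :=
  calc a⁻¹ * b * s = a⁻¹ * (b * s * b⁻¹) * b := by group
    _ = a⁻¹ * (a * s * a⁻¹) * b := by rw [h]
    _ = s * (a⁻¹ * b) := by group

/-- The element `γ` of the centralizer of `s` with `h * g t = g (h t h⁻¹) * γ`. -/
def ClassReps.γ (T : ClassReps s) (h : G) (t : conjugatesOf s) :
    Subgroup.centralizer ({s} : Set G) :=
  ⟨(T.g (classConj h t))⁻¹ * (h * T.g t), by
    rw [Subgroup.mem_centralizer_singleton_iff]
    refine conj_aux ?_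
    have h1 := T.conj_eq (classConj h t)
    rw [h1, mul_inv_rev, ← mul_assoc, mul_assoc h, mul_assoc h, T.conj_eq t]
    rfl⟩

variable {V : Type w} [AddCommGroup V] [Module k V]

/-- The Yetter-Drinfeld module `M(O_s, ρ) = ⨁ g_t ⊗ V`, where `t` runs over the conjugacy
class of `s` and `g_t ⊗ v` is `Finsupp.single t v`. The coaction is `δ (g_t v) = t ⊗ g_t v` and the
action is `h · (g_t v) = g_{t'} (γ · v)` where `h g_t = g_{t'} γ` with `γ` centralizing `s`. -/
def classModule (ρ : Representation k (Subgroup.centralizer ({s} : Set G)) V) (T : ClassReps s) :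
    YDModule k G (conjugatesOf s →₀ V) where
  act :=
    { toFun := fun h => Finsupp.lsum k fun t => Finsupp.lsingle (classConj h t) ∘ₗ ρ (T.γ h t)
      map_one' := by
        ext t v : 2
        have h1 : classConj 1 t = t := Subtype.ext (by simp [classConj])
        have h2 : T.γ 1 t = 1 := Subtype.ext (by simp [ClassReps.γ, h1])
        simp [h1, h2]
      map_mul' := fun h h' => by
        ext t v : 2
        have h1 : classConj (h * h') t = classConj h (classConj h' t) :=
          Subtype.ext (by simp [classConj, mul_assoc])
        have h2 : T.γ (h * h') t = T.γ h (classConj h' t) * T.γ h' t :=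
          Subtype.ext (by simp [ClassReps.γ, h1, mul_assoc])
        simp [h1, h2] }
  coact := Finsupp.lsum k fun t => TensorProduct.mk k _ _ (gl k (t : G)) ∘ₗ Finsupp.lsingle t
  counit_coact x := by
    induction x using finsupp_ind with
    | zero => simp
    | add x y hx hy => simp only [map_add, hx, hy]
    | single t v => simp [gl]
  coassoc x := by
    induction x using finsupp_ind with
    | zero => simp
    | add x y hx hy => simp only [map_add, hx, hy]
    | single t v => simp [gl]
  coact_act h x := by
    induction x using finsupp_ind with
    | zero => simp
    | add x y hx hy => simp only [map_add, hx, hy]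
    | single t v => simp [gl, conj, MonoidAlgebra.single_mul_single, classConj, mul_assoc]

end ClassModule

/-! ### Ramification systems with irreducible representations and arrow modules -/

section Arrow

variable (k : Type u) (G : Type v) [Field k] [Group G]

/-- A ramification system with irreducible representations `(G, r, ρ, u)`: a ramification
`r = ∑ r_C C` of `G`, representatives `u C ∈ C`, finite index sets `I_C(r, u)`, irreducible
*right* representations `ρ_C⁽ⁱ⁾` of the centralizer of `u C` (that is, representations of the
opposite group), and sets `J_C(i)` of cardinality `deg ρ_C⁽ⁱ⁾`, such that the set
`I_C(r) = {(i, j) | i ∈ I_C(r, u), j ∈ J_C(i)}` has cardinality `r_C`. In particular, `I_C(r, u)`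
is empty if `r_C = 0`. -/
structure RSR where
  r : ConjClasses G → Cardinal.{w}
  u : ConjClasses G → G
  mk_u : ∀ C, ConjClasses.mk (u C) = C
  I : ConjClasses G → Type w
  finite_I : ∀ C, Finite (I C)
  X : ∀ C, I C → Type w
  [addCommGroup : ∀ C i, AddCommGroup (X C i)]
  [module : ∀ C i, Module k (X C i)]
  ρ : ∀ C i, Representation k (Subgroup.centralizer ({u C} : Set G))ᵐᵒᵖ (X C i)
  irreducible : ∀ C i, (ρ C i).IsIrreducible
  J : ∀ C, I C → Type w
  card_J : ∀ C i, Cardinal.mk (J C i) = Module.rank k (X C i)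
  card_I : ∀ C, Cardinal.mk (Σ i : I C, J C i) = r C

attribute [instance] RSR.addCommGroup RSR.module

/-- A Hopf bimodule over `kG`: a bimodule and bicomodule whose coactions are bimodule maps. -/
structure HopfBimodule (B : Type w) [AddCommGroup B] [Module k B] where
  lact : Representation k G B
  ract : Representation k Gᵐᵒᵖ B
  lact_ract : ∀ g h x, lact g (ract h x) = ract h (lact g x)
  lcoact : B →ₗ[k] MonoidAlgebra k G ⊗[k] B
  rcoact : B →ₗ[k] B ⊗[k] MonoidAlgebra k G
  lcounit : ∀ x, TensorProduct.lid k B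
    ((Coalgebra.counit (R := k) (A := MonoidAlgebra k G)).rTensor B (lcoact x)) = x
  lcoassoc : ∀ x, TensorProduct.assoc k _ _ B
    ((Coalgebra.comul (R := k) (A := MonoidAlgebra k G)).rTensor B (lcoact x)) =
      lcoact.lTensor (MonoidAlgebra k G) (lcoact x)
  rcounit : ∀ x, TensorProduct.rid k B
    ((Coalgebra.counit (R := k) (A := MonoidAlgebra k G)).lTensor B (rcoact x)) = x
  rcoassoc : ∀ x, TensorProduct.assoc k B _ _ (rcoact.rTensor (MonoidAlgebra k G) (rcoact x)) =
    (Coalgebra.comul (R := k) (A := MonoidAlgebra k G)).lTensor B (rcoact x)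
  lcoact_rcoact : ∀ x, TensorProduct.assoc k _ B _
    (lcoact.rTensor (MonoidAlgebra k G) (rcoact x)) =
      rcoact.lTensor (MonoidAlgebra k G) (lcoact x)
  lcoact_lact : ∀ g x, lcoact (lact g x) =
    TensorProduct.map (LinearMap.mulLeft k (gl k g)) (lact g) (lcoact x)
  lcoact_ract : ∀ g x, lcoact (ract (MulOpposite.op g) x) =
    TensorProduct.map (LinearMap.mulRight k (gl k g)) (ract (MulOpposite.op g)) (lcoact x)
  rcoact_lact : ∀ g x, rcoact (lact g x) =
    TensorProduct.map (lact g) (LinearMap.mulLeft k (gl k g)) (rcoact x)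
  rcoact_ract : ∀ g x, rcoact (ract (MulOpposite.op g) x) =
    TensorProduct.map (ract (MulOpposite.op g)) (LinearMap.mulRight k (gl k g)) (rcoact x)

variable {k G}

/-- The Yetter-Drinfeld module given by a Hopf bimodule: the action is `g ▷ x = g · x · g⁻¹` and
the coaction is the left coaction. -/
def HopfBimodule.toYD {B : Type w} [AddCommGroup B] [Module k B] (H : HopfBimodule k G B) :
    YDModule k G B where
  act :=
    { toFun := fun g => H.ract (MulOpposite.op g⁻¹) ∘ₗ H.lact g
      map_one' := by ext; simp
      map_mul' := fun g h => by
        ext x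
        simp [H.lact_ract] }
  coact := H.lcoact
  counit_coact := H.lcounit
  coassoc := H.lcoassoc
  coact_act g x := by
    change H.lcoact (H.ract (MulOpposite.op g⁻¹) (H.lact g x)) =
      TensorProduct.map (conj k g) (H.ract (MulOpposite.op g⁻¹) ∘ₗ H.lact g) (H.lcoact x)
    rw [H.lcoact_ract, H.lcoact_lact]
    generalize H.lcoact x = z
    induction z using TensorProduct.induction_on with
    | zero => simp
    | add a b ha hb => simp only [map_add, ha, hb]
    | tmul a b => simp [conj, mul_assoc]

namespace RSR

variable (R : RSR.{u, v, w} k G)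

/-- The ramification system is bi-one: the ramification is supported on one conjugacy class `C`,
and `I_C(r, u)` has exactly one element. -/
def IsBiOne : Prop :=
  ∃ C, (∀ C', R.r C' ≠ 0 ↔ C' = C) ∧ Nonempty (Unique (R.I C))

/-- The arrows of the Hopf quiver with vertex set `G` and ramification data `r`. The arrow
`a_{y,x}^{(i,j)}` has start vertex `x = src` and end vertex `y = tgt`, where `x⁻¹ y` lies in the
conjugacy class `C` and `(i, j) ∈ I_C(r)`. -/
structure Arrow where
  src : G
  tgt : G
  C : ConjClasses G
  mk_eq : ConjClasses.mk (src⁻¹ * tgt) = C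
  i : R.I C
  j : R.J C i

/-- The choices needed to write down the module structure on the arrows: for every conjugacy
class `C`, right coset representatives of the centralizer of `u C` in `G`, indexed by the elements
`c = (T c)⁻¹ (u C) (T c)` of `C`, and a basis of the representation space of every `ρ_C⁽ⁱ⁾`
indexed by `J_C(i)`. -/
structure Choices where
  T : G → G
  conj_eq : ∀ c, (T c)⁻¹ * R.u (ConjClasses.mk c) * T c = c
  basis : ∀ C i, Module.Basis (R.J C i) k (R.X C i)

instance : Nonempty R.Choices := by
  have h : ∀ c : G, ∃ g : G, g⁻¹ * R.u (ConjClasses.mk c) * g = c := fun c => by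
    obtain ⟨g, hg⟩ := isConj_iff.mp (ConjClasses.mk_eq_mk_iff_isConj.mp (R.mk_u (.mk c)))
    exact ⟨g⁻¹, by rw [inv_inv, hg]⟩
  have b : ∀ C i, Nonempty (Module.Basis (R.J C i) k (R.X C i)) := fun C i => by
    have e := (R.card_J C i).trans (Module.Basis.ofVectorSpace k (R.X C i)).mk_eq_rank''.symm
    exact ⟨(Module.Basis.ofVectorSpace k (R.X C i)).reindex (Cardinal.eq.mp e).some.symm⟩
  exact ⟨⟨fun c => (h c).choose, fun c => (h c).choose_spec, fun C i => (b C i).some⟩⟩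

variable {R}

theorem mk_conj {c g : G} : ConjClasses.mk (g⁻¹ * c * g) = ConjClasses.mk c :=
  ConjClasses.mk_eq_mk_iff_isConj.mpr (isConj_iff.mpr ⟨g, by group⟩)

/-- The element `ζ` of the centralizer of `u C` with `T c * g = ζ * T (g⁻¹ c g)`, for `c ∈ C`. -/
def Choices.ζ (D : R.Choices) (C : ConjClasses G) (c : G) (hc : ConjClasses.mk c = C) (g : G) :
    Subgroup.centralizer ({R.u C} : Set G) :=
  ⟨D.T c * g * (D.T (g⁻¹ * c * g))⁻¹, by
    subst hc
    rw [Subgroup.mem_centralizer_singleton_iff]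
    have h1 := D.conj_eq c
    have h2 := D.conj_eq (g⁻¹ * c * g)
    rw [mk_conj] at h2
    have h3 := conj_aux (a := (D.T c)⁻¹) (b := g * (D.T (g⁻¹ * c * g))⁻¹)
      (s := R.u (ConjClasses.mk c)) (by
        rw [inv_inv, h1, mul_inv_rev, inv_inv]
        generalize D.T (g⁻¹ * c * g) = b at h2
        have : c = g * (b⁻¹ * R.u (ConjClasses.mk c) * b) * g⁻¹ := by rw [h2]; group
        conv_lhs => rw [this]
        group)
    simpa [mul_assoc] using h3⟩

/-- The vector `∑ⱼ xⱼ a_{y,x}^{(i,j)}` of arrows given by a vector of the representation space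
with coordinates `xⱼ`. -/
def Choices.emb (D : R.Choices) (x y : G) (C : ConjClasses G)
    (h : ConjClasses.mk (x⁻¹ * y) = C) (i : R.I C) : R.X C i →ₗ[k] (R.Arrow →₀ k) :=
  Finsupp.lmapDomain k k (fun j => (⟨x, y, C, h, i, j⟩ : R.Arrow)) ∘ₗ
    (D.basis C i).repr.toLinearMap

theorem Choices.emb_basis (D : R.Choices) (x y : G) (C : ConjClasses G)
    (h : ConjClasses.mk (x⁻¹ * y) = C) (i : R.I C) (j : R.J C i) :
    D.emb x y C h i (D.basis C i j) = Finsupp.single ⟨x, y, C, h, i, j⟩ 1 := by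
  simp [emb]

/-- Every linear combination of arrows is a sum of vectors from `Choices.emb`. -/
theorem Choices.induction (D : R.Choices) {P : (R.Arrow →₀ k) → Prop} (zero : P 0)
    (add : ∀ x y, P x → P y → P (x + y)) (emb : ∀ x y C h i v, P (D.emb x y C h i v))
    (z : R.Arrow →₀ k) : P z := by
  induction z using finsupp_ind with
  | zero => exact zero
  | add x y hx hy => exact add x y hx hy
  | single a r =>
    obtain ⟨x, y, C, h, i, j⟩ := a
    have := emb x y C h i (r • D.basis C i j)
    rw [map_smul, D.emb_basis] at this
    simpa using this

theorem emb_ext {A : Type*} [AddCommMonoid A] [Module k A] (D : R.Choices) (x y : G)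
    (C : ConjClasses G) (h : ConjClasses.mk (x⁻¹ * y) = C) (i : R.I C)
    {f : (R.Arrow →₀ k) →ₗ[k] A} {f' : R.X C i →ₗ[k] A}
    (hf : ∀ j, f (Finsupp.single ⟨x, y, C, h, i, j⟩ 1) = f' (D.basis C i j)) (v : R.X C i) :
    f (D.emb x y C h i v) = f' v := by
  have : f ∘ₗ D.emb x y C h i = f' := (D.basis C i).ext fun j => by
    rw [LinearMap.comp_apply, D.emb_basis, hf]
  exact LinearMap.congr_fun this v

theorem left_mk {x y : G} {C : ConjClasses G} (g : G) (h : ConjClasses.mk (x⁻¹ * y) = C) :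
    ConjClasses.mk ((g * x)⁻¹ * (g * y)) = C := by
  rw [← h]; congr 1; group

theorem right_mk {x y : G} {C : ConjClasses G} (g : G) (h : ConjClasses.mk (x⁻¹ * y) = C) :
    ConjClasses.mk ((x * g)⁻¹ * (y * g)) = C := by
  have : (x * g)⁻¹ * (y * g) = g⁻¹ * (x⁻¹ * y) * g := by group
  rw [this, mk_conj, h]

/-- The left action `g · a_{y,x}^{(i,j)} = a_{gy,gx}^{(i,j)}`. -/
def leftMul (R : RSR.{u, v, w} k G) (g : G) : (R.Arrow →₀ k) →ₗ[k] (R.Arrow →₀ k) :=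
  Finsupp.lmapDomain k k fun a => ⟨g * a.src, g * a.tgt, a.C, left_mk g a.mk_eq, a.i, a.j⟩

/-- The right action `a_{y,x}^{(i,j)} · g = ∑ₚ κₚ a_{yg,xg}^{(i,p)}`, where the `κₚ` are the
coordinates of the vector `x_j · ζ` obtained from the basis vector `x_j` by the right action of
the element `ζ` attached to `c = x⁻¹ y` and `g`. -/
def Choices.rightMul (D : R.Choices) (g : G) : (R.Arrow →₀ k) →ₗ[k] (R.Arrow →₀ k) :=
  Finsupp.lift _ k _ fun a =>
    D.emb (a.src * g) (a.tgt * g) a.C (right_mk g a.mk_eq) a.i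
      (R.ρ a.C a.i (MulOpposite.op (D.ζ a.C (a.src⁻¹ * a.tgt) a.mk_eq g)) (D.basis a.C a.i a.j))

theorem leftMul_emb (D : R.Choices) (g x y : G) (C : ConjClasses G)
    (h : ConjClasses.mk (x⁻¹ * y) = C) (i : R.I C) (v : R.X C i) :
    R.leftMul g (D.emb x y C h i v) = D.emb (g * x) (g * y) C (left_mk g h) i v :=
  emb_ext D x y C h i (fun j => by rw [D.emb_basis]; simp [leftMul]) v

theorem rightMul_emb (D : R.Choices) (g x y : G) (C : ConjClasses G)
    (h : ConjClasses.mk (x⁻¹ * y) = C) (i : R.I C) (v : R.X C i) :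
    D.rightMul g (D.emb x y C h i v) = D.emb (x * g) (y * g) C (right_mk g h) i
      (R.ρ C i (MulOpposite.op (D.ζ C (x⁻¹ * y) h g)) v) :=
  emb_ext D x y C h i (f' := D.emb (x * g) (y * g) C (right_mk g h) i ∘ₗ
    R.ρ C i (MulOpposite.op (D.ζ C (x⁻¹ * y) h g))) (fun j => by simp [Choices.rightMul]) v

/-- The left coaction `a ↦ t(a) ⊗ a`. -/
def arrowLCoact (R : RSR.{u, v, w} k G) :
    (R.Arrow →₀ k) →ₗ[k] MonoidAlgebra k G ⊗[k] (R.Arrow →₀ k) :=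
  Finsupp.lift _ k _ fun a => gl k a.tgt ⊗ₜ Finsupp.single a 1

/-- The right coaction `a ↦ a ⊗ s(a)`. -/
def arrowRCoact (R : RSR.{u, v, w} k G) :
    (R.Arrow →₀ k) →ₗ[k] (R.Arrow →₀ k) ⊗[k] MonoidAlgebra k G :=
  Finsupp.lift _ k _ fun a => Finsupp.single a 1 ⊗ₜ gl k a.src

theorem arrowLCoact_emb (D : R.Choices) (x y : G) (C : ConjClasses G)
    (h : ConjClasses.mk (x⁻¹ * y) = C) (i : R.I C) (v : R.X C i) :
    R.arrowLCoact (D.emb x y C h i v) = gl k y ⊗ₜ D.emb x y C h i v :=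
  emb_ext D x y C h i (f' := TensorProduct.mk k _ _ (gl k y) ∘ₗ D.emb x y C h i)
    (fun j => by simp [arrowLCoact, D.emb_basis]) v

theorem arrowRCoact_emb (D : R.Choices) (x y : G) (C : ConjClasses G)
    (h : ConjClasses.mk (x⁻¹ * y) = C) (i : R.I C) (v : R.X C i) :
    R.arrowRCoact (D.emb x y C h i v) = D.emb x y C h i v ⊗ₜ gl k x := by
  let φ : (R.Arrow →₀ k) →ₗ[k] (R.Arrow →₀ k) ⊗[k] MonoidAlgebra k G :=
    (TensorProduct.mk k (R.Arrow →₀ k) (MonoidAlgebra k G)).flip (gl k x)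
  exact emb_ext D x y C h i (f := R.arrowRCoact) (f' := φ ∘ₗ D.emb x y C h i)
    (fun j => by simp [φ, arrowRCoact, D.emb_basis]) v

theorem emb_congr (D : R.Choices) {x y x' y' : G} (C : ConjClasses G)
    {h : ConjClasses.mk (x⁻¹ * y) = C} {h' : ConjClasses.mk (x'⁻¹ * y') = C} (i : R.I C)
    {v v' : R.X C i} (hx : x = x') (hy : y = y') (hv : v = v') :
    D.emb x y C h i v = D.emb x' y' C h' i v' := by
  subst hx hy hv; rfl

/-- The Hopf bimodule `kQ₁` on the arrows of the Hopf quiver. -/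
def arrowBimodule (D : R.Choices) : HopfBimodule k G (R.Arrow →₀ k) where
  lact :=
    { toFun := R.leftMul
      map_one' := by
        refine LinearMap.ext fun z => ?_
        induction z using D.induction with
        | zero => simp
        | add x y hx hy => simp only [map_add, hx, hy]
        | emb x y C h i v =>
          rw [leftMul_emb]; exact emb_congr D C i (one_mul _) (one_mul _) rfl
      map_mul' := fun g g' => by
        refine LinearMap.ext fun z => ?_
        induction z using D.induction with
        | zero => simp
        | add x y hx hy => simp only [map_add, hx, hy]
        | emb x y C h i v =>
          rw [Module.End.mul_apply, leftMul_emb, leftMul_emb, leftMul_emb]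
          exact emb_congr D C i (mul_assoc _ _ _) (mul_assoc _ _ _) rfl }
  ract :=
    { toFun := fun g => D.rightMul g.unop
      map_one' := by
        refine LinearMap.ext fun z => ?_
        induction z using D.induction with
        | zero => simp
        | add x y hx hy => simp only [map_add, hx, hy]
        | emb x y C h i v =>
          rw [rightMul_emb]
          have : D.ζ C (x⁻¹ * y) h 1 = 1 := Subtype.ext (by simp [Choices.ζ])
          exact emb_congr D C i (mul_one _) (mul_one _) (by simp [this])
      map_mul' := fun g g' => by
        refine LinearMap.ext fun z => ?_
        induction z using D.induction with
        | zero => simp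
        | add x y hx hy => simp only [map_add, hx, hy]
        | emb x y C h i v =>
          rw [Module.End.mul_apply, rightMul_emb, rightMul_emb, rightMul_emb]
          refine emb_congr D C i (mul_assoc _ _ _).symm (mul_assoc _ _ _).symm ?_
          rw [← Module.End.mul_apply, ← map_mul, ← MulOpposite.op_mul]
          congr 3
          refine Subtype.ext ?_
          simp [Choices.ζ, mul_assoc] }
  lact_ract g g' z := by
    change R.leftMul g (D.rightMul g'.unop z) = D.rightMul g'.unop (R.leftMul g z)
    induction z using D.induction with
    | zero => simp
    | add x y hx hy => simp only [map_add, hx, hy]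
    | emb x y C h i v =>
      rw [rightMul_emb, leftMul_emb, leftMul_emb, rightMul_emb]
      refine emb_congr D C i (mul_assoc _ _ _).symm (mul_assoc _ _ _).symm ?_
      congr 3
      refine Subtype.ext ?_
      simp [Choices.ζ, mul_assoc]
  lcoact := R.arrowLCoact
  rcoact := R.arrowRCoact
  lcounit z := by
    induction z using D.induction with
    | zero => simp
    | add x y hx hy => simp only [map_add, hx, hy]
    | emb x y C h i v => simp [arrowLCoact_emb, gl]
  lcoassoc z := by
    induction z using D.induction with
    | zero => simp
    | add x y hx hy => simp only [map_add, hx, hy]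
    | emb x y C h i v => simp [arrowLCoact_emb, gl]
  rcounit z := by
    induction z using D.induction with
    | zero => simp
    | add x y hx hy => simp only [map_add, hx, hy]
    | emb x y C h i v => simp [arrowRCoact_emb, gl]
  rcoassoc z := by
    induction z using D.induction with
    | zero => simp
    | add x y hx hy => simp only [map_add, hx, hy]
    | emb x y C h i v => simp [arrowRCoact_emb, gl]
  lcoact_rcoact z := by
    induction z using D.induction with
    | zero => simp
    | add x y hx hy => simp only [map_add, hx, hy]
    | emb x y C h i v => simp [arrowRCoact_emb, arrowLCoact_emb]
  lcoact_lact g z := by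
    change R.arrowLCoact (R.leftMul g z) = TensorProduct.map _ (R.leftMul g) _
    induction z using D.induction with
    | zero => simp
    | add x y hx hy => simp only [map_add, hx, hy]
    | emb x y C h i v =>
      simp [arrowLCoact_emb, leftMul_emb, gl, MonoidAlgebra.single_mul_single]
  lcoact_ract g z := by
    change R.arrowLCoact (D.rightMul g z) = TensorProduct.map _ (D.rightMul g) _
    induction z using D.induction with
    | zero => simp
    | add x y hx hy => simp only [map_add, hx, hy]
    | emb x y C h i v =>
      simp [arrowLCoact_emb, rightMul_emb, gl, MonoidAlgebra.single_mul_single]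
  rcoact_lact g z := by
    change R.arrowRCoact (R.leftMul g z) = TensorProduct.map (R.leftMul g) _ _
    induction z using D.induction with
    | zero => simp
    | add x y hx hy => simp only [map_add, hx, hy]
    | emb x y C h i v =>
      simp [arrowRCoact_emb, leftMul_emb, gl, MonoidAlgebra.single_mul_single]
  rcoact_ract g z := by
    change R.arrowRCoact (D.rightMul g z) = TensorProduct.map (D.rightMul g) _ _
    induction z using D.induction with
    | zero => simp
    | add x y hx hy => simp only [map_add, hx, hy]
    | emb x y C h i v =>
      simp [arrowRCoact_emb, rightMul_emb, gl, MonoidAlgebra.single_mul_single]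

/-- The span `kQ₁¹` of the arrows with start vertex `1`. -/
def arrowsAtOne (R : RSR.{u, v, w} k G) : Submodule k (R.Arrow →₀ k) :=
  Submodule.span k {z | ∃ a : R.Arrow, a.src = 1 ∧ z = Finsupp.single a 1}

theorem emb_mem (D : R.Choices) {x y : G} {C : ConjClasses G}
    (h : ConjClasses.mk (x⁻¹ * y) = C) (i : R.I C) (v : R.X C i) (hx : x = 1) :
    D.emb x y C h i v ∈ R.arrowsAtOne := by
  rw [← (D.basis C i).linearCombination_repr v, Finsupp.linearCombination_apply, Finsupp.sum,
    map_sum]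
  refine sum_mem fun j _ => ?_
  rw [map_smul, D.emb_basis]
  exact Submodule.smul_mem _ _ (Submodule.subset_span ⟨_, hx, rfl⟩)

/-- The arrow Yetter-Drinfeld module `(kQ₁¹, ad(G, r, ρ, u))`. -/
def arrowYD (D : R.Choices) : YDModule k G R.arrowsAtOne :=
  (arrowBimodule D).toYD.restrict R.arrowsAtOne
    (fun g z hz => by
      refine (Submodule.span_le (p := R.arrowsAtOne.comap ((arrowBimodule D).toYD.act g))).mpr
        ?_ hz
      rintro _ ⟨⟨x, y, C, h, i, j⟩, hx, rfl⟩
      change D.rightMul g⁻¹ (R.leftMul g _) ∈ R.arrowsAtOne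
      rw [← D.emb_basis, leftMul_emb, rightMul_emb]
      refine emb_mem D _ _ _ ?_
      rw [show x = 1 from hx, mul_one, mul_inv_cancel])
    (fun z hz => by
      refine (Submodule.span_le (p := (LinearMap.range
        (R.arrowsAtOne.subtype.lTensor (MonoidAlgebra k G))).comap
          (arrowBimodule D).toYD.coact)).mpr ?_ hz
      rintro _ ⟨a, ha, rfl⟩
      refine ⟨gl k a.tgt ⊗ₜ ⟨Finsupp.single a 1, Submodule.subset_span ⟨a, ha, rfl⟩⟩, ?_⟩
      change _ = R.arrowLCoact _
      simp [arrowLCoact])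

/-- The arrow Nichols algebra of a ramification system. -/
def arrowNichols (D : R.Choices) :
    GradedBraidedHopfAlgebra.{u, v, max u v w} k G :=
  nicholsAlgebra (arrowYD D)

end RSR

end Arrow

end BiOneNichols

end

/-!
The ramification system is supported on the class of `s`, with `u = s` there and with the single
right representation `x · ζ = ρ(ζ⁻¹) x` on `V`, which is irreducible because inversion is an
isomorphism from the opposite of the centralizer to the centralizer.

Let `t = g_t s g_t⁻¹` and `τ_t⁻¹ s τ_t = t`. Then `τ_t g_t` centralizes `s`, and the
isomorphism `M(O_s, ρ) → kQ₁¹` sends `g_t v` to the combination of the arrows from `1` to `t` with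
coefficient vector `ρ(τ_t g_t) v`. It preserves degrees, hence is colinear. For the action of `h`,
put `t' = h t h⁻¹`: on the left `h g_t = g_{t'} γ`, while on the right the arrows from `1` to `t`
are moved to those from `1` to `t'` by `ρ(ζ⁻¹)` with `ζ = τ_t h⁻¹ τ_{t'}⁻¹`, and
`τ_{t'} g_{t'} γ = τ_{t'} h g_t = ζ⁻¹ τ_t g_t` (`comparisonEquiv_γ`).

The statement on Nichols algebras follows by functoriality. An isomorphism of Yetter-Drinfeld
modules extends to the tensor algebras (`YDIso.tensorHopf`). Preimages of homogeneous Hopf ideals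
in degrees at least two are of the same kind, so the largest such ideals correspond
(`YDIso.nicholsIdeal_eq_comap`) and the isomorphism descends to the quotients.
-/

noncomputable section

namespace BiOneNichols

section Functoriality

variable {k : Type u} {G : Type v} [Field k] [Group G]

/-! ### Transport of Hopf ideals and quotients along isomorphisms -/

namespace GradedBraidedHopfIso

variable {A : GradedBraidedHopfAlgebra.{u, v, w} k G} {B : GradedBraidedHopfAlgebra.{u, v, w'} k G}

theorem symm_comp_toLinearMap (e : GradedBraidedHopfIso A B) :
    e.toAlgEquiv.symm.toLinearMap ∘ₗ e.toAlgEquiv.toLinearMap = LinearMap.id :=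
  LinearMap.ext e.toAlgEquiv.symm_apply_apply

/-- The inverse of an isomorphism of graded braided Hopf algebras. -/
def symm (e : GradedBraidedHopfIso A B) : GradedBraidedHopfIso B A where
  toAlgEquiv := e.toAlgEquiv.symm
  map_act g b := by
    obtain ⟨a, rfl⟩ := e.toAlgEquiv.surjective b
    rw [← e.map_act, AlgEquiv.symm_apply_apply, AlgEquiv.symm_apply_apply]
  map_coact b := by
    obtain ⟨a, rfl⟩ := e.toAlgEquiv.surjective b
    rw [e.map_coact, AlgEquiv.symm_apply_apply, ← LinearMap.comp_apply, ← LinearMap.lTensor_comp,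
      symm_comp_toLinearMap, LinearMap.lTensor_id, LinearMap.id_apply]
  map_comul b := by
    obtain ⟨a, rfl⟩ := e.toAlgEquiv.surjective b
    rw [e.map_comul, AlgEquiv.symm_apply_apply, ← LinearMap.comp_apply, ← TensorProduct.map_comp,
      symm_comp_toLinearMap, TensorProduct.map_id, LinearMap.id_apply]
  map_counit b := by
    obtain ⟨a, rfl⟩ := e.toAlgEquiv.surjective b
    rw [e.map_counit, AlgEquiv.symm_apply_apply]
  map_antipode b := by
    obtain ⟨a, rfl⟩ := e.toAlgEquiv.surjective b
    rw [← e.map_antipode, AlgEquiv.symm_apply_apply, AlgEquiv.symm_apply_apply]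
  map_deg n := by
    rw [← e.map_deg, ← Submodule.map_comp,
      symm_comp_toLinearMap, Submodule.map_id]

/-- The inverse isomorphism, as a linear map from an ideal to its preimage. -/
def restrictSymm (e : GradedBraidedHopfIso A B) (K : Ideal B.carrier) :
    K.restrictScalars k →ₗ[k] (K.comap e.toAlgEquiv).restrictScalars k :=
  (e.toAlgEquiv.symm.toLinearMap ∘ₗ (K.restrictScalars k).subtype).codRestrict _ fun b => by
    change e.toAlgEquiv (e.toAlgEquiv.symm b) ∈ K
    rw [AlgEquiv.apply_symm_apply]
    exact b.2

theorem subtype_comp_restrictSymm (e : GradedBraidedHopfIso A B) (K : Ideal B.carrier) :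
    ((K.comap e.toAlgEquiv).restrictScalars k).subtype ∘ₗ e.restrictSymm K =
      e.toAlgEquiv.symm.toLinearMap ∘ₗ (K.restrictScalars k).subtype := rfl

theorem isHopfIdeal_comap (e : GradedBraidedHopfIso A B) {K : Ideal B.carrier}
    (hK : IsHopfIdeal B K) : IsHopfIdeal A (K.comap e.toAlgEquiv) := by
  refine ⟨⟨fun b ha => ?_⟩, fun a ha => ?_, fun g a ha => ?_, fun a ha => ?_, fun a ha => ?_,
    fun a ha => ?_, fun a ha => ?_⟩
  · rw [Ideal.mem_comap] at ha ⊢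
    rw [map_mul]
    exact hK.twoSided.mul_mem_of_left _ ha
  · have h : (⨆ n, K.restrictScalars k ⊓ B.deg n) ≤
        (⨆ n, (K.comap e.toAlgEquiv).restrictScalars k ⊓ A.deg n).map
          e.toAlgEquiv.toLinearMap := by
      refine iSup_le fun n => ?_
      rintro b ⟨hb, hbn⟩
      rw [← e.map_deg] at hbn
      obtain ⟨c, hc, rfl⟩ := hbn
      exact ⟨c, Submodule.mem_iSup_of_mem n ⟨hb, hc⟩, rfl⟩
    obtain ⟨c, hc, hca⟩ := h (hK.homogeneous ha)
    rwa [← e.toAlgEquiv.injective hca]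
  · rw [Ideal.mem_comap] at ha ⊢
    rw [e.map_act]
    exact hK.act_mem g _ ha
  · obtain ⟨z, hz⟩ := hK.coact_mem _ ha
    refine ⟨(e.restrictSymm K).lTensor _ z, ?_⟩
    have h := e.symm.map_coact (e.toAlgEquiv a)
    change A.yd.coact (e.toAlgEquiv.symm (e.toAlgEquiv a)) =
      e.toAlgEquiv.symm.toLinearMap.lTensor _ _ at h
    rw [AlgEquiv.symm_apply_apply] at h
    rw [h, ← hz, ← LinearMap.comp_apply, ← LinearMap.comp_apply, ← LinearMap.lTensor_comp,
      ← LinearMap.lTensor_comp, subtype_comp_restrictSymm]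
  · obtain ⟨_, ⟨x, rfl⟩, _, ⟨y, rfl⟩, hxy⟩ := Submodule.mem_sup.mp (hK.comul_mem _ ha)
    have h := e.symm.map_comul (e.toAlgEquiv a)
    change A.comul (e.toAlgEquiv.symm (e.toAlgEquiv a)) =
      TensorProduct.map e.toAlgEquiv.symm.toLinearMap e.toAlgEquiv.symm.toLinearMap _ at h
    rw [AlgEquiv.symm_apply_apply] at h
    rw [h, ← hxy, map_add]
    refine Submodule.add_mem_sup
      ⟨TensorProduct.map (e.restrictSymm K) e.toAlgEquiv.symm.toLinearMap x, ?_⟩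
      ⟨TensorProduct.map e.toAlgEquiv.symm.toLinearMap (e.restrictSymm K) y, ?_⟩
    · rw [← LinearMap.comp_apply, ← LinearMap.comp_apply, LinearMap.rTensor_comp_map,
        LinearMap.map_comp_rTensor, subtype_comp_restrictSymm]
    · rw [← LinearMap.comp_apply, ← LinearMap.comp_apply, LinearMap.lTensor_comp_map,
        LinearMap.map_comp_lTensor, subtype_comp_restrictSymm]
  · rw [← e.map_counit]
    exact hK.counit_mem _ ha
  · rw [Ideal.mem_comap] at ha ⊢
    rw [e.map_antipode]
    exact hK.antipode_mem _ ha

/-- An isomorphism carrying a Hopf ideal `J` onto a Hopf ideal `K` induces an isomorphism of the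
quotients. -/
def quotient (e : GradedBraidedHopfIso A B) {J : Ideal A.carrier} {K : Ideal B.carrier}
    (hJ : IsHopfIdeal A J) (hK : IsHopfIdeal B K) (h : J = K.comap e.toAlgEquiv) :
    GradedBraidedHopfIso hJ.quotient hK.quotient :=
  haveI := hJ.twoSided
  haveI := hK.twoSided
  let f : (A.carrier ⧸ J) ≃ₐ[k] (B.carrier ⧸ K) := Ideal.quotientEquivAlg J K e.toAlgEquiv (by
    rw [h]
    exact (Ideal.map_comap_of_surjective (e.toAlgEquiv : A.carrier →+* B.carrier)
      e.toAlgEquiv.surjective K).symm)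
  have hf : ∀ a, f (IsHopfIdeal.proj J a) = IsHopfIdeal.proj K (e.toAlgEquiv a) := fun _ => rfl
  have hf' : f.toLinearMap ∘ₗ IsHopfIdeal.proj J =
      IsHopfIdeal.proj K ∘ₗ e.toAlgEquiv.toLinearMap := rfl
  { toAlgEquiv := f
    map_act := fun g x => by
      obtain ⟨a, rfl⟩ := IsHopfIdeal.proj_surjective x
      change f (IsHopfIdeal.proj J (A.yd.act g a)) =
        IsHopfIdeal.proj K (B.yd.act g (e.toAlgEquiv a))
      rw [hf, e.map_act]
    map_coact := fun x => by
      obtain ⟨a, rfl⟩ := IsHopfIdeal.proj_surjective x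
      change (IsHopfIdeal.proj K).lTensor _ (B.yd.coact (e.toAlgEquiv a)) =
        f.toLinearMap.lTensor _ ((IsHopfIdeal.proj J).lTensor _ (A.yd.coact a))
      rw [e.map_coact, ← LinearMap.lTensor_comp_apply, ← LinearMap.lTensor_comp_apply, hf']
    map_comul := fun x => by
      obtain ⟨a, rfl⟩ := IsHopfIdeal.proj_surjective x
      change TensorProduct.map (IsHopfIdeal.proj K) (IsHopfIdeal.proj K)
          (B.comul (e.toAlgEquiv a)) = TensorProduct.map f.toLinearMap f.toLinearMap
        (TensorProduct.map (IsHopfIdeal.proj J) (IsHopfIdeal.proj J) (A.comul a))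
      rw [e.map_comul, TensorProduct.map_map, TensorProduct.map_map, hf']
    map_counit := fun x => by
      obtain ⟨a, rfl⟩ := IsHopfIdeal.proj_surjective x
      exact e.map_counit a
    map_antipode := fun x => by
      obtain ⟨a, rfl⟩ := IsHopfIdeal.proj_surjective x
      change f (IsHopfIdeal.proj J (A.antipode a)) =
        IsHopfIdeal.proj K (B.antipode (e.toAlgEquiv a))
      rw [hf, e.map_antipode]
    map_deg := fun n => by
      change ((A.deg n).map (IsHopfIdeal.proj J)).map f.toLinearMap =
        (B.deg n).map (IsHopfIdeal.proj K)
      rw [← Submodule.map_comp, hf', Submodule.map_comp, e.map_deg] }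

end GradedBraidedHopfIso

/-! ### Functoriality of tensor algebras and Nichols algebras -/

namespace YDIso

variable {V : Type w} [AddCommGroup V] [Module k V] {W : Type w'} [AddCommGroup W] [Module k W]
  {M : YDModule k G V} {N : YDModule k G W}

/-- The inverse of an isomorphism of Yetter-Drinfeld modules. -/
def symm (e : YDIso M N) : YDIso N M where
  toLinearEquiv := e.toLinearEquiv.symm
  map_act g w := by
    obtain ⟨v, rfl⟩ := e.toLinearEquiv.surjective w
    rw [← e.map_act, LinearEquiv.symm_apply_apply, LinearEquiv.symm_apply_apply]
  map_coact w := by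
    obtain ⟨v, rfl⟩ := e.toLinearEquiv.surjective w
    rw [e.map_coact, LinearEquiv.symm_apply_apply, ← LinearMap.comp_apply,
      ← LinearMap.lTensor_comp]
    simp

theorem isHomog (e : YDIso M N) {g : G} {v : V} (hv : M.IsHomog g v) :
    N.IsHomog g (e.toLinearEquiv v) := by
  have h : M.coact v = gl k g ⊗ₜ v := hv
  simp [YDModule.IsHomog, e.map_coact, h]

/-- The algebra isomorphism of tensor algebras extending an isomorphism of Yetter-Drinfeld
modules. -/
def tensorAlgEquiv (e : YDIso M N) : TensorAlgebra k V ≃ₐ[k] TensorAlgebra k W :=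
  AlgEquiv.ofAlgHom
    (TensorAlgebra.lift k (TensorAlgebra.ι k ∘ₗ e.toLinearEquiv.toLinearMap))
    (TensorAlgebra.lift k (TensorAlgebra.ι k ∘ₗ e.toLinearEquiv.symm.toLinearMap))
    (by ext; simp) (by ext; simp)

@[simp] theorem tensorAlgEquiv_ι (e : YDIso M N) (v : V) :
    e.tensorAlgEquiv (TensorAlgebra.ι k v) = TensorAlgebra.ι k (e.toLinearEquiv v) := by
  simp [tensorAlgEquiv]

theorem tensorAlgEquiv_act (e : YDIso M N) (g : G) (t : TensorAlgebra k V) :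
    e.tensorAlgEquiv (TA.act M g t) = TA.act N g (e.tensorAlgEquiv t) := by
  have h : e.tensorAlgEquiv.toAlgHom.comp (TA.act M g) =
      (TA.act N g).comp e.tensorAlgEquiv.toAlgHom := by
    ext v; simp [e.map_act]
  exact AlgHom.congr_fun h t

theorem tensorAlgEquiv_coact (e : YDIso M N) (t : TensorAlgebra k V) :
    TA.coact N (e.tensorAlgEquiv t) =
      e.tensorAlgEquiv.toLinearMap.lTensor (MonoidAlgebra k G) (TA.coact M t) := by
  have h : (TA.coact N).comp e.tensorAlgEquiv.toAlgHom =
      (Algebra.TensorProduct.map (AlgHom.id k (MonoidAlgebra k G))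
        e.tensorAlgEquiv.toAlgHom).comp (TA.coact M) := by
    ext v
    change TA.coact N (e.tensorAlgEquiv (TensorAlgebra.ι k v)) =
      e.tensorAlgEquiv.toLinearMap.lTensor (MonoidAlgebra k G) (TA.coact M (TensorAlgebra.ι k v))
    rw [tensorAlgEquiv_ι, TA.coact_ι, TA.coact_ι, e.map_coact,
      ← LinearMap.lTensor_comp_apply, ← LinearMap.lTensor_comp_apply]
    congr 2
    ext v
    simp
  exact AlgHom.congr_fun h t

theorem tensorAlgEquiv_comul (e : YDIso M N) (t : TensorAlgebra k V) :
    TA.comul N (e.tensorAlgEquiv t) =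
      TensorProduct.map e.tensorAlgEquiv.toLinearMap e.tensorAlgEquiv.toLinearMap
        (TA.comul M t) := by
  induction t using TA.induction M with
  | zero => simp
  | one => simp [TA.comul_one]
  | add x y hx hy => simp only [map_add, hx, hy]
  | smul r x hx => simp only [map_smul, hx]
  | mul g v x hv hx =>
    rw [map_mul, tensorAlgEquiv_ι, TA.comul_ι_mul, hx, TA.comul_ι_mul]
    generalize TA.comul M x = z
    induction z using TensorProduct.induction_on with
    | zero => simp
    | add a b ha hb => simp only [map_add, ha, hb]
    | tmul a b =>
      simp [TA.mulPrimitive_homog M hv, TA.mulPrimitive_homog N (e.isHomog hv),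
        tensorAlgEquiv_act]

theorem tensorAlgEquiv_antipode (e : YDIso M N) (t : TensorAlgebra k V) :
    e.tensorAlgEquiv (TA.antipode M t) = TA.antipode N (e.tensorAlgEquiv t) := by
  induction t using TA.induction M with
  | zero => simp
  | one => simp [TA.antipode_one]
  | add x y hx hy => simp only [map_add, hx, hy]
  | smul r x hx => simp only [map_smul, hx]
  | mul g v x hv hx =>
    rw [map_mul e.tensorAlgEquiv, tensorAlgEquiv_ι, TA.antipode_ι_mul, TA.antipode_ι_mul, ← hx,
      TA.antipodeOp_homog M hv, TA.antipodeOp_homog N (e.isHomog hv), map_neg,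
      map_mul e.tensorAlgEquiv,
      tensorAlgEquiv_ι, tensorAlgEquiv_act]

theorem tensorAlgEquiv_counit (e : YDIso M N) (t : TensorAlgebra k V) :
    TA.counit (e.tensorAlgEquiv t) = TA.counit t := by
  have h : TA.counit.comp e.tensorAlgEquiv.toAlgHom = (TA.counit : TensorAlgebra k V →ₐ[k] k) := by
    ext v; simp
  exact AlgHom.congr_fun h t

theorem map_grading (e : YDIso M N) (n : ℕ) :
    (TA.grading k V n).map e.tensorAlgEquiv.toLinearMap = TA.grading k W n := by
  change Submodule.map e.tensorAlgEquiv.toAlgHom.toLinearMap _ = _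
  rw [TA.grading, Submodule.map_pow, ← LinearMap.range_comp]
  have h : e.tensorAlgEquiv.toAlgHom.toLinearMap ∘ₗ TensorAlgebra.ι k =
      TensorAlgebra.ι k ∘ₗ e.toLinearEquiv.toLinearMap := by
    ext v; simp
  rw [h, LinearMap.range_comp, LinearEquiv.range, Submodule.map_top]

/-- Isomorphic Yetter-Drinfeld modules have isomorphic tensor algebras. -/
def tensorHopf (e : YDIso M N) : GradedBraidedHopfIso (tensorHopf M) (tensorHopf N) where
  toAlgEquiv := e.tensorAlgEquiv
  map_act := e.tensorAlgEquiv_act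
  map_coact := e.tensorAlgEquiv_coact
  map_comul := e.tensorAlgEquiv_comul
  map_counit := e.tensorAlgEquiv_counit
  map_antipode := e.tensorAlgEquiv_antipode
  map_deg := e.map_grading

/-- The preimage of a Hopf ideal of the kind defining the Nichols algebra is again one, hence is
contained in the largest. -/
theorem comap_nicholsIdeal_le (e : YDIso M N) :
    (nicholsIdeal N).comap e.tensorHopf.toAlgEquiv ≤ nicholsIdeal M := by
  refine le_sSup ⟨e.tensorHopf.isHopfIdeal_comap (nicholsIdeal_isHopfIdeal N), fun a ha => ?_⟩
  have hdeg : (nicholsIdeal N).restrictScalars k ≤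
      ⨆ n : ℕ, (BiOneNichols.tensorHopf N).deg (n + 2) := by
    intro b hb
    have hb' : b ∈ nicholsIdeal N := hb
    rw [nicholsIdeal, sSup_eq_iSup'] at hb'
    exact Submodule.iSup_induction _
      (motive := fun b => b ∈ ⨆ n : ℕ, (BiOneNichols.tensorHopf N).deg (n + 2)) hb'
      (fun J x hx => J.2.2 hx) (zero_mem _) (fun _ _ => add_mem)
  have h := hdeg ha
  simp only [← e.tensorHopf.map_deg, ← Submodule.map_iSup] at h
  obtain ⟨c, hc, hca⟩ := h
  rwa [← e.tensorHopf.toAlgEquiv.injective hca]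

theorem nicholsIdeal_eq_comap (e : YDIso M N) :
    nicholsIdeal M = (nicholsIdeal N).comap e.tensorHopf.toAlgEquiv := by
  refine le_antisymm (fun a ha => e.symm.comap_nicholsIdeal_le ?_) e.comap_nicholsIdeal_le
  rw [Ideal.mem_comap]
  have : e.symm.tensorHopf.toAlgEquiv (e.tensorHopf.toAlgEquiv a) = a :=
    e.tensorAlgEquiv.symm_apply_apply a
  rwa [this]

/-- Isomorphic Yetter-Drinfeld modules have isomorphic Nichols algebras. -/
def nicholsAlgebra (e : YDIso M N) :
    GradedBraidedHopfIso (nicholsAlgebra M) (nicholsAlgebra N) :=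
  e.tensorHopf.quotient (nicholsIdeal_isHopfIdeal M) (nicholsIdeal_isHopfIdeal N)
    e.nicholsIdeal_eq_comap

end YDIso

end Functoriality

/-! ### The ramification system of a centralizer representation -/

theorem isIrreducible_comp {k H H' V : Type*} [Field k] [Monoid H] [Monoid H'] [AddCommGroup V]
    [Module k V] (ρ : Representation k H V) (hρ : ρ.IsIrreducible) (f : H' →* H)
    (hf : Function.Surjective f) : Representation.IsIrreducible (ρ.comp f) := by
  let e : Subrepresentation (ρ.comp f) ≃o Subrepresentation ρ :=
    { toFun := fun σ => ⟨σ.toSubmodule, fun h v hv => by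
        obtain ⟨h, rfl⟩ := hf h
        exact σ.apply_mem_toSubmodule h hv⟩
      invFun := fun σ => ⟨σ.toSubmodule, fun h v hv => σ.apply_mem_toSubmodule (f h) hv⟩
      left_inv := fun _ => rfl
      right_inv := fun _ => rfl
      map_rel_iff' := Iff.rfl }
  exact e.isSimpleOrder_iff.mpr hρ

section

variable {k : Type u} {G : Type v} [Field k] [Group G] {s : G}
  {V : Type w} [AddCommGroup V] [Module k V]

/-- Inversion as an isomorphism from the opposite group of the centralizer of `t` to the
centralizer of `s`, for `t = s`. It turns left representations into right ones. -/
def centralizerInv {s t : G} (h : t = s) :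
    (Subgroup.centralizer ({t} : Set G))ᵐᵒᵖ ≃* Subgroup.centralizer ({s} : Set G) :=
  (MulEquiv.inv' _).symm.trans (MulEquiv.subgroupCongr (by rw [h]))

open Classical in
/-- Representatives of the conjugacy classes, the one of the class of `s` being `s` itself. -/
def classRep (s : G) (C : ConjClasses G) : G :=
  if C = ConjClasses.mk s then s else Quotient.out C

theorem classRep_of_eq {C : ConjClasses G} (h : C = ConjClasses.mk s) : classRep s C = s :=
  if_pos h

theorem mk_classRep (C : ConjClasses G) : ConjClasses.mk (classRep s C) = C := by
  unfold classRep
  split_ifs with h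
  · exact h.symm
  · exact Quotient.out_eq C

/-- The bi-one ramification system of a representation `ρ` of the centralizer of `s`: the index
set of a class is the proposition that it is the class of `s`, as a type, and the one right
representation is `x · ζ = ρ(ζ⁻¹) x`. -/
def biOneRSR (ρ : Representation k (Subgroup.centralizer ({s} : Set G)) V)
    (hρ : ρ.IsIrreducible) : RSR.{u, v, w} k G where
  r C := Cardinal.mk
    (Σ _ : ULift.{w} (PLift (C = ConjClasses.mk s)), Module.Basis.ofVectorSpaceIndex k V)
  u := classRep s
  mk_u := mk_classRep
  I C := ULift.{w} (PLift (C = ConjClasses.mk s))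
  finite_I _ := inferInstance
  X _ _ := V
  ρ _ i := ρ.comp (centralizerInv (classRep_of_eq i.down.down)).toMonoidHom
  irreducible _ _ := isIrreducible_comp ρ hρ _ (centralizerInv _).surjective
  J _ _ := Module.Basis.ofVectorSpaceIndex k V
  card_J _ _ := (Module.Basis.ofVectorSpace k V).mk_eq_rank''
  card_I _ := rfl

variable {ρ : Representation k (Subgroup.centralizer ({s} : Set G)) V} (hρ : ρ.IsIrreducible)

theorem biOneRSR_isBiOne : (biOneRSR ρ hρ).IsBiOne := by
  have : Nontrivial V := by
    by_contra h
    rw [not_nontrivial_iff_subsingleton] at h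
    obtain ⟨σ, τ, hne⟩ := hρ.exists_pair_ne
    exact hne (Subrepresentation.toSubmodule_injective (Subsingleton.elim _ _))
  have : Nonempty (Module.Basis.ofVectorSpaceIndex k V) :=
    (Module.Basis.ofVectorSpace k V).index_nonempty
  refine ⟨ConjClasses.mk s, fun C => ?_, ⟨⟨⟨⟨⟨rfl⟩⟩⟩, fun ⟨⟨_⟩⟩ => rfl⟩⟩⟩
  rw [show (biOneRSR ρ hρ).r C = Cardinal.mk (Σ _ : ULift.{w} (PLift (C = ConjClasses.mk s)),
    Module.Basis.ofVectorSpaceIndex k V) from rfl, Cardinal.mk_ne_zero_iff]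
  exact ⟨fun ⟨i, _⟩ => i.down.down, fun h => ⟨⟨⟨⟨h⟩⟩, Classical.arbitrary _⟩⟩⟩

/-! ### The isomorphism with the arrow module -/

theorem YDModule.subtype_restrict_coact {W : Type*} [AddCommGroup W] [Module k W]
    (M : YDModule k G W) (N : Submodule k W) (h1 : ∀ g, ∀ x ∈ N, M.act g x ∈ N)
    (h2 : ∀ x ∈ N, M.coact x ∈ LinearMap.range (N.subtype.lTensor (MonoidAlgebra k G))) (x : N) :
    N.subtype.lTensor (MonoidAlgebra k G) ((M.restrict N h1 h2).coact x) = M.coact x :=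
  congrArg Subtype.val ((LinearEquiv.ofInjective (N.subtype.lTensor (MonoidAlgebra k G))
    (Module.Flat.lTensor_preserves_injective_linearMap _
      N.injective_subtype)).apply_symm_apply ⟨M.coact x, h2 x x.2⟩)

variable {hρ} (T : ClassReps s) (D : (biOneRSR ρ hρ).Choices)

theorem mk_eq_of_mem (t : conjugatesOf s) :
    ConjClasses.mk ((1 : G)⁻¹ * t) = ConjClasses.mk s := by
  rw [inv_one, one_mul]
  exact (ConjClasses.mk_eq_mk_iff_isConj.mpr t.2).symm

/-- The element `τ_t g_t`, comparing the two coset representatives attached to `t`. It lies in the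
centralizer of `s`, as `g_t` conjugates `s` to `t` and `τ_t` conjugates `t` back to `s`. -/
def comparison (t : conjugatesOf s) : Subgroup.centralizer ({s} : Set G) :=
  ⟨D.T t * T.g t, by
    rw [Subgroup.mem_centralizer_singleton_iff]
    have h1 := T.conj_eq t
    have h2 := D.conj_eq t
    have h3 : (biOneRSR ρ hρ).u (ConjClasses.mk (t : G)) = s :=
      classRep_of_eq (ConjClasses.mk_eq_mk_iff_isConj.mpr t.2).symm
    rw [h3] at h2
    have := conj_aux (a := (D.T t)⁻¹) (b := T.g t) (s := s) (by rw [inv_inv, h1, h2])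
    simpa using this⟩

/-- The unique index of a representation at the class of `s`. -/
abbrev classIndex (hρ : ρ.IsIrreducible) : (biOneRSR ρ hρ).I (ConjClasses.mk s) := ⟨⟨rfl⟩⟩

/-- The linear isomorphism `v ↦ τ_t g_t · v` from `V` to the representation space attached to the
class of `s`, which is a copy of `V`. -/
def comparisonEquiv (t : conjugatesOf s) :
    V ≃ₗ[k] (biOneRSR ρ hρ).X (ConjClasses.mk s) (classIndex hρ) :=
  show V ≃ₗ[k] V from LinearEquiv.ofLinearMap (ρ (comparison T D t)) (ρ (comparison T D t)⁻¹)
    (by rw [← Module.End.mul_eq_comp, ← map_mul, mul_inv_cancel, map_one, Module.End.one_eq_id])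
    (by rw [← Module.End.mul_eq_comp, ← map_mul, inv_mul_cancel, map_one, Module.End.one_eq_id])

/-- The comparison maps intertwine the action of `γ` on `M(O_s, ρ)` with that of `ζ` on the
arrows: both composites are the action of `τ_{hth⁻¹} h g_t`. -/
theorem comparisonEquiv_γ (h : G) (t : conjugatesOf s) (c : G)
    (hc : ConjClasses.mk c = ConjClasses.mk s) (hct : c = t) (v : V) :
    comparisonEquiv T D (classConj h t) (ρ (T.γ h t) v) =
      (biOneRSR ρ hρ).ρ (ConjClasses.mk s) (classIndex hρ) (MulOpposite.op (D.ζ _ c hc h⁻¹))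
        (comparisonEquiv T D t v) := by
  change ρ _ (ρ _ v) = ρ (centralizerInv _ (MulOpposite.op _)) (ρ _ v)
  rw [← Module.End.mul_apply, ← Module.End.mul_apply, ← map_mul, ← map_mul]
  congr 2
  refine Subtype.ext ?_
  change (comparison T D (classConj h t) : G) * T.γ h t = (D.ζ _ c hc h⁻¹ : G)⁻¹ * comparison T D t
  subst hct
  simp [comparison, ClassReps.γ, RSR.Choices.ζ, classConj, mul_assoc]

/-- The linear map `g_t v ↦ τ_t g_t · v`, the vector on the right being read as a combination of
the arrows from `1` to `t`. -/
def toArrows : (conjugatesOf s →₀ V) →ₗ[k] ((biOneRSR ρ hρ).Arrow →₀ k) :=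
  Finsupp.lsum k fun t =>
    D.emb 1 t (ConjClasses.mk s) (mk_eq_of_mem t) (classIndex hρ) ∘ₗ
      (comparisonEquiv T D t).toLinearMap

theorem toArrows_single (t : conjugatesOf s) (v : V) :
    toArrows T D (Finsupp.single t v) =
      D.emb 1 t (ConjClasses.mk s) (mk_eq_of_mem t) (classIndex hρ) (comparisonEquiv T D t v) := by
  simp [toArrows]

theorem toArrows_act (h : G) (x : conjugatesOf s →₀ V) :
    toArrows T D ((classModule ρ T).act h x) =
      (RSR.arrowBimodule D).toYD.act h (toArrows T D x) := by
  induction x using finsupp_ind with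
  | zero => simp
  | add x y hx hy => simp only [map_add, hx, hy]
  | single t v =>
    have e : (classModule ρ T).act h (Finsupp.single t v) =
        Finsupp.single (classConj h t) (ρ (T.γ h t) v) := by simp [classModule]
    rw [e, toArrows_single, toArrows_single]
    change _ = D.rightMul h⁻¹ (RSR.leftMul _ h _)
    rw [RSR.leftMul_emb, RSR.rightMul_emb]
    exact RSR.emb_congr D _ _ (by simp) rfl (comparisonEquiv_γ T D h t _ _ (by group) v)

theorem toArrows_coact (x : conjugatesOf s →₀ V) :
    RSR.arrowLCoact _ (toArrows T D x) =
      (toArrows T D).lTensor (MonoidAlgebra k G) ((classModule ρ T).coact x) := by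
  induction x using finsupp_ind with
  | zero => simp
  | add x y hx hy => simp only [map_add, hx, hy]
  | single t v =>
    rw [toArrows_single, RSR.arrowLCoact_emb]
    simp [classModule, toArrows_single]

/-- The coefficient of the arrow from `1` to `t` with index `j` in the image of `x` is a
coordinate of `τ_t g_t · x_t`. -/
theorem toArrows_apply (x : conjugatesOf s →₀ V) (t : conjugatesOf s)
    (j : (biOneRSR ρ hρ).J (ConjClasses.mk s) (classIndex hρ)) :
    toArrows T D x ⟨1, t, ConjClasses.mk s, mk_eq_of_mem t, classIndex hρ, j⟩ =
      (D.basis (ConjClasses.mk s) (classIndex hρ)).repr (comparisonEquiv T D t (x t)) j := by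
  classical
  induction x using finsupp_ind with
  | zero => simp
  | add x y hx hy => simp only [map_add, Finsupp.add_apply, hx, hy]
  | single t' v =>
    rw [toArrows_single]
    change Finsupp.mapDomain _ _ _ = _
    by_cases h : t' = t
    · subst h
      rw [Finsupp.mapDomain_apply (f := fun j => RSR.Arrow.mk (1 : G) (t' : G)
        (ConjClasses.mk s) (mk_eq_of_mem t') (classIndex hρ) j), Finsupp.single_eq_same]
      · rfl
      · intro a b hab
        simpa using hab
    · rw [Finsupp.mapDomain_of_notMem_range, Finsupp.single_eq_of_ne (Ne.symm h), map_zero,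
        map_zero, Finsupp.zero_apply]
      rintro ⟨a, ha⟩
      exact h (Subtype.ext (congrArg RSR.Arrow.tgt ha))

theorem toArrows_injective : Function.Injective (toArrows T D) := by
  refine (injective_iff_map_eq_zero _).mpr fun x hx => ?_
  ext t
  refine (comparisonEquiv T D t).injective ?_
  refine (D.basis (ConjClasses.mk s) (classIndex hρ)).repr.injective ?_
  ext j
  rw [← toArrows_apply, hx]
  simp

theorem range_toArrows : LinearMap.range (toArrows T D) = (biOneRSR ρ hρ).arrowsAtOne := by
  refine le_antisymm ?_ (Submodule.span_le.mpr ?_)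
  · rintro _ ⟨x, rfl⟩
    induction x using finsupp_ind with
    | zero => simp
    | add x y hx hy => rw [map_add]; exact add_mem hx hy
    | single t v =>
      rw [toArrows_single]
      exact RSR.emb_mem D _ _ _ rfl
  · rintro _ ⟨⟨x, y, C, h, i, j⟩, hx, rfl⟩
    -- an index `i` is a proof that the class `C` of `y` is the class of `s`
    obtain rfl : C = ConjClasses.mk s := i.down.down
    obtain rfl : i = classIndex hρ := rfl
    obtain rfl : x = 1 := hx
    have hy : y ∈ conjugatesOf s := by
      rw [inv_one, one_mul] at h
      exact ConjClasses.mk_eq_mk_iff_isConj.mp h.symm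
    refine ⟨Finsupp.single ⟨y, hy⟩
      ((comparisonEquiv T D ⟨y, hy⟩).symm (D.basis _ (classIndex hρ) j)), ?_⟩
    rw [toArrows_single, LinearEquiv.apply_symm_apply]
    exact RSR.Choices.emb_basis _ _ _ _ _ _ _

/-- The isomorphism of Yetter-Drinfeld modules from `M(O_s, ρ)` to `kQ₁¹`. -/
def classModuleIso : YDIso (classModule ρ T) (RSR.arrowYD D) where
  toLinearEquiv := (LinearEquiv.ofInjective _ (toArrows_injective T D)).trans
    (LinearEquiv.ofEq _ _ (range_toArrows T D))
  map_act g v := Subtype.ext (toArrows_act T D g v)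
  map_coact v := by
    -- the coactions agree in `kG ⊗ kQ₁`, into which `kG ⊗ kQ₁¹` embeds by flatness
    apply Module.Flat.lTensor_preserves_injective_linearMap (M := MonoidAlgebra k G) _
      (biOneRSR ρ hρ).arrowsAtOne.injective_subtype
    rw [RSR.arrowYD, YDModule.subtype_restrict_coact, ← LinearMap.lTensor_comp_apply]
    exact toArrows_coact T D v

end

end BiOneNichols

end

theorem lemma4p1 {G : Type v} [Group G] (s : G) {V : Type w} [AddCommGroup V] [Module ℂ V]
    (ρ : Representation ℂ (Subgroup.centralizer ({s} : Set G)) V) (hρ : ρ.IsIrreducible) :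
    ∃ R : BiOneNichols.RSR.{0, v, w} ℂ G, R.IsBiOne ∧
      ∀ (T : BiOneNichols.ClassReps s) (D : R.Choices),
        Nonempty (BiOneNichols.YDIso (BiOneNichols.classModule ρ T)
          (BiOneNichols.RSR.arrowYD D)) ∧
        Nonempty (BiOneNichols.GradedBraidedHopfIso
          (BiOneNichols.nicholsAlgebra (BiOneNichols.classModule ρ T))
          (BiOneNichols.RSR.arrowNichols D)) := by
  exact ⟨BiOneNichols.biOneRSR ρ hρ, BiOneNichols.biOneRSR_isBiOne hρ, fun T D =>
    ⟨⟨BiOneNichols.classModuleIso T D⟩, ⟨(BiOneNichols.classModuleIso T D).nicholsAlgebra⟩⟩⟩
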